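/- Let $p\equiv 3\pmod 4$ be a prime, $n$ an odd positive integer, $q=p^n$, and let $V=\mathbb F_q^3$ (column vectors), an elementary abelian group of order $q^3$. Let $\mathrm{Aut}(V)$ be the group of all automorphisms of the additive group of $V$, and let $A=ES\le \mathrm{Aut}(V)$, where $$E=\left\{\begin{pmatrix}1&x&x^2/2\\0&1&x\\0&0&1\end{pmatrix}\ :\ x\in\mathbb F_q\right\},\qquad S=\{sI_3 : s\in\mathbb F_q^*\text{ a square}\}.$$ A skew Hadamard difference set in $V$ is a difference set $D\subset V$ such that $V\setminus\{0\}$ is the disjoint union of $D$ and $-D$. Let $\mathbb D$ be the set of all $A$-invariant skew Hadamard difference sets in $V$, and for $D\in\mathbb D$ let $\mathrm{des}(D)=\{D+h : h\in V\}$ be the translation design with point set $V$ generated by $D$. Two such designs are isomorphic if some permutation of $V$ maps the block set of the first onto that of the second. Then: 1. $|N_{\mathrm{Aut}(V)}(A)|=n(q-1)^2q^2$ and $[N_{\mathrm{Aut}(V)}(A):A]=2n(q-1)q$. 2. For each $D\in\mathbb D$, $\mathrm{des}(D)$ is a symmetric $2$-$\left(q^3,\frac{q^3-1}{2},\frac{q^3-3}{4}\right)$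 design. Moreover $|\mathbb D|=4\binom{q}{(q+1)/2}$, and there are exactly $4\binom{q}{(q+1)/2}$ distinct designs $\mathrm{des}(D)$, $D\in\mathbb D$. 3. The number of isomorphism classes of the designs $\mathrm{des}(D)$, $D\in\mathbb D$, is at least $$\frac{4\binom{q}{(q+1)/2}}{2n(q-1)q}\;>\;\frac{2^{q+2}/q}{2nq(q-1)}\;>\;\frac{2^{q+1}}{q^4}.$$ In particular, it grows exponentially in $q$. -/

import Mathlib

open scoped Pointwise

/-! ### Difference sets and designs -/

section Designs

/-- `D` is a `(v, k, l)`-difference set of the (additive) finite group `H`: `|H| = v`, `|D| = k`, and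
every non-zero `h` is a difference of elements of `D` in exactly `l` ways. -/
def IsDifferenceSet {H : Type*} [AddCommGroup H] (D : Set H) (v k l : ℕ) : Prop :=
  Nat.card H = v ∧ D.ncard = k ∧
    ∀ h : H, h ≠ 0 → {x : H × H | x.1 ∈ D ∧ x.2 ∈ D ∧ x.1 - x.2 = h}.ncard = l

/-- A skew Hadamard difference set: a difference set `D` such that `H \ {0}` is the disjoint union
of `D` and `-D`. -/
def IsSkewHadamard {H : Type*} [AddCommGroup H] (D : Set H) : Prop :=
  (∃ v k l : ℕ, IsDifferenceSet D v k l) ∧ D ∪ -D = {0}ᶜ ∧ Disjoint D (-D)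

/-- The block set of the translation design generated by `D`: all translates `D + h`. -/
def translationDesign {H : Type*} [AddCommGroup H] (D : Set H) : Set (Set H) :=
  {B | ∃ h : H, B = (fun d => d + h) '' D}

/-- `𝓑` is the block set of a symmetric `2-(v, k, l)` design on the point set `X`. -/
structure IsSymmetricDesign {X : Type*} (𝓑 : Set (Set X)) (v k l : ℕ) : Prop where
  card_points : Nat.card X = v
  card_blocks : 𝓑.ncard = v
  card_block : ∀ B ∈ 𝓑, B.ncard = k
  card_pair : ∀ x y : X, x ≠ y → {B ∈ 𝓑 | x ∈ B ∧ y ∈ B}.ncard = l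

/-- Isomorphism of designs on the point set `X` (given by their block sets): some permutation of
the points maps the blocks of the first exactly onto the blocks of the second. -/
def DesignIso {X : Type*} (𝓑 𝓑' : Set (Set X)) : Prop :=
  ∃ g : Equiv.Perm X, (fun B : Set X => g '' B) '' 𝓑 = 𝓑'

theorem designIso_equivalence (X : Type*) : Equivalence (DesignIso (X := X)) where
  refl 𝓑 := ⟨1, by simp⟩
  symm := by
    rintro 𝓑 _ ⟨g, rfl⟩
    refine ⟨g⁻¹, ?_⟩
    rw [Set.image_image]
    simp [Set.image_image]
  trans := by
    rintro 𝓑 _ _ ⟨g, rfl⟩ ⟨h, rfl⟩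
    refine ⟨h * g, ?_⟩
    rw [Set.image_image]
    simp [Set.image_image]

/-- The isomorphism relation on designs with point set `X`. -/
def designSetoid (X : Type*) : Setoid (Set (Set X)) :=
  ⟨DesignIso, designIso_equivalence X⟩

/-- The number of isomorphism classes represented in a set of designs on `X`. -/
noncomputable def numIsoClasses {X : Type*} (𝒞 : Set (Set (Set X))) : ℕ :=
  (Quotient.mk (designSetoid X) '' 𝒞).ncard

end Designs

/-! ### The group `A` and the `A`-invariant skew Hadamard difference sets -/

section GroupA

variable (F : Type*) [Field F]

variable {F} in
/-- The unipotent matrix `E(x)`. -/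
def matE (x : F) : Matrix (Fin 3) (Fin 3) F :=
  !![1, x, x ^ 2 / 2; 0, 1, x; 0, 0, 1]

/-- `Aut(V)`: all automorphisms of the additive group of `V = F³` (the `ℤ`-linear ones; they need not
be `F`-linear). -/
abbrev AutV : Type _ := (Fin 3 → F) ≃ₗ[ℤ] (Fin 3 → F)

/-- The group `E = {E(x) | x ∈ F}`, acting on column vectors. In characteristic different from two
the generating set is already a subgroup; the same holds for `groupS`. -/
def groupE : Subgroup (AutV F) :=
  Subgroup.closure {g | ∃ x : F, ∀ v, g v = (matE x).mulVec v}

/-- The group `S` of scalar maps `s I₃`, with `s` a non-zero square. -/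
def groupS : Subgroup (AutV F) :=
  Subgroup.closure {g | ∃ s : F, s ≠ 0 ∧ IsSquare s ∧ ∀ v, g v = s • v}

/-- `A = E S`, as a subgroup of `Aut(V)`. -/
def groupA : Subgroup (AutV F) := groupE F ⊔ groupS F

/-- The set of all `A`-invariant skew Hadamard difference sets of `V = F³`. -/
def invariantSHDS : Set (Set (Fin 3 → F)) :=
  {D | IsSkewHadamard D ∧ ∀ g ∈ groupA F, g '' D = D}

/-- The translation designs generated by the `A`-invariant skew Hadamard difference sets. -/
def invariantDesigns : Set (Set (Set (Fin 3 → F))) :=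
  translationDesign '' invariantSHDS F

end GroupA

/-!
An automorphism normalizing `A` normalizes its Sylow subgroup `E`, so comparing matrix entries
forces it to be upper triangular and semilinear. Such maps are parametrised by a field automorphism,
two units and two field elements, whence the order of the normalizer.

An `A`-invariant skew set is an odd sign function that is constant on the orbits of `A`, hence is
given by signs `α`, `β` and a function `ε : F → {±1}`. Its Fourier transform is the quadratic Gauss
sum times an explicit integer, and the difference set condition, that all nontrivial character
values have the same absolute value, becomes `∑ t, ε t = χ 2 * α` with `χ` the quadratic character.
Of the `2 * 2` choices for `α` and `β`, each leaves `q.choose ((q + 1) / 2)` functions `ε`.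

Let `P` be the `p`-group generated by the translations and `E`; it acts on every one of the designs.
A `p`-group of automorphisms of a design that normalizes `P` is affine, and its linear parts form an
extension of `E` by field automorphisms. Since `|Aut F| ^ 2 < q`, this extension is too small to
contain a conjugate of `P` different from `P`. By Sylow's theorem an isomorphism between two of the
designs can then be corrected, by an automorphism of the target, to one normalizing `P`. The
corrected map is affine with linear part in the normalizer of `A`, because a sign function with sum
`±1` has no nonzero period. Hence an isomorphism class contains at most `[N(A) : A]` designs.
-/

section DifferenceSets

variable {H : Type*} [AddCommGroup H] {D : Set H}

/-- The autocorrelation of `f` at the shift `h`. -/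
def autocorrelation [Fintype H] {R : Type*} [Semiring R] (f : H → R) (h : H) : R :=
  ∑ x, f x * f (x + h)

lemma sum_autocorrelation [Fintype H] {R : Type*} [Semiring R] (f : H → R) :
    ∑ h, autocorrelation f h = (∑ x, f x) * ∑ x, f x := by
  simp only [autocorrelation]
  rw [Finset.sum_comm, Finset.sum_mul]
  refine Finset.sum_congr rfl fun x _ => ?_
  rw [← Finset.mul_sum, ← Equiv.sum_comp (Equiv.addLeft x) f]
  rfl

/-- The sign function of `D`: the indicator of `D` minus the indicator of `-D`. -/
noncomputable def setSign (D : Set H) (v : H) : ℤ :=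
  D.indicator 1 v - (-D).indicator 1 v

lemma setSign_neg (D : Set H) (v : H) : setSign D (-v) = -setSign D v := by
  classical simp [setSign, Set.indicator_apply]

lemma setSign_zero (D : Set H) : setSign D 0 = 0 := by
  classical simp [setSign, Set.indicator_apply]

lemma sum_setSign [Fintype H] (D : Set H) : ∑ v, setSign D v = 0 := by
  have hneg : ∑ v, setSign D v = -∑ v, setSign D v := by
    simp only [← Finset.sum_neg_distrib, ← setSign_neg]
    exact (Equiv.sum_comp (Equiv.neg H) (setSign D)).symm
  linarith

omit [AddCommGroup H] in
lemma sum_indicator_one [Fintype H] (D : Set H) : ∑ x, D.indicator (1 : H → ℤ) x = D.ncard := by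
  classical
  simp [Set.indicator_apply, Finset.sum_boole, Set.ncard_eq_toFinset_card']

lemma autocorrelation_indicator_one [Fintype H] (D : Set H) (h : H) :
    autocorrelation (D.indicator (1 : H → ℤ)) h = {x | x ∈ D ∧ x + h ∈ D}.ncard := by
  rw [← sum_indicator_one]
  refine Finset.sum_congr rfl fun x _ => ?_
  by_cases h₁ : x ∈ D <;> by_cases h₂ : x + h ∈ D <;> simp [h₁, h₂]

lemma ncard_differences (D : Set H) (h : H) :
    {x : H × H | x.1 ∈ D ∧ x.2 ∈ D ∧ x.1 - x.2 = h}.ncard = {x | x ∈ D ∧ x + h ∈ D}.ncard := by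
  have hinj : Function.Injective fun x : H => (x + h, x) := fun x y hxy => congrArg Prod.snd hxy
  rw [← Set.ncard_image_of_injective _ hinj]
  congr 1
  ext ⟨x, y⟩
  simp only [Set.mem_ofPred_eq, Set.mem_image, Prod.mk.injEq]
  constructor
  · rintro ⟨hx, hy, rfl⟩
    exact ⟨y, ⟨hy, by simpa using hx⟩, by simp, rfl⟩
  · rintro ⟨z, ⟨hz, hz'⟩, rfl, rfl⟩
    exact ⟨hz', hz, by simp⟩

lemma IsDifferenceSet.image_addEquiv {v k l : ℕ} (hD : IsDifferenceSet D v k l) (φ : H ≃+ H) :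
    IsDifferenceSet (φ '' D) v k l := by
  obtain ⟨hv, hk, hl⟩ := hD
  refine ⟨hv, by rw [Set.ncard_image_of_injective _ φ.injective, hk], fun h hh => ?_⟩
  rw [← hl (φ.symm h) (by simpa using hh), ncard_differences, ncard_differences,
    ← Set.ncard_image_of_injective {x | x ∈ D ∧ x + φ.symm h ∈ D} φ.injective]
  congr 1
  ext x
  obtain ⟨y, rfl⟩ := φ.surjective x
  have hyh : φ y + h = φ (y + φ.symm h) := by simp
  simp only [Set.mem_ofPred_eq, hyh, φ.injective.mem_set_image]

/-- `D` is skew: the non-zero elements are the disjoint union of `D` and `-D`. -/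
def IsSkew (D : Set H) : Prop := D ∪ -D = {0}ᶜ ∧ Disjoint D (-D)

namespace IsSkew

lemma zero_notMem (hD : IsSkew D) : (0 : H) ∉ D := fun h =>
  (hD.1 ▸ Or.inl h : (0 : H) ∈ ({0}ᶜ : Set H)) rfl

lemma neg_mem_iff (hD : IsSkew D) {v : H} (hv : v ≠ 0) : -v ∈ D ↔ v ∉ D := by
  refine ⟨fun h h' => Set.disjoint_left.1 hD.2 h' h, fun h => ?_⟩
  exact (hD.1 ▸ hv : v ∈ D ∪ -D).resolve_left h

lemma image_addEquiv (hD : IsSkew D) (φ : H ≃+ H) : IsSkew (φ '' D) := by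
  have hneg : -(φ '' D) = φ '' (-D) := by
    simp only [← Set.image_neg_eq_neg, Set.image_image, map_neg]
  rw [IsSkew, hneg, ← Set.image_union, hD.1, Set.image_compl_eq φ.bijective, Set.image_singleton,
    map_zero]
  exact ⟨rfl, (Set.disjoint_image_iff φ.injective).2 hD.2⟩

open Classical in
lemma setSign_eq (hD : IsSkew D) (v : H) :
    setSign D v = 2 * D.indicator 1 v - 1 + (if v = 0 then 1 else 0) := by
  by_cases hv : v = 0
  · subst hv
    simp [setSign_zero, hD.zero_notMem]
  · have := hD.neg_mem_iff hv
    by_cases h : v ∈ D <;> simp [setSign, h, this, hv]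

lemma setSign_eq_one_iff (hD : IsSkew D) {v : H} : setSign D v = 1 ↔ v ∈ D := by
  rw [hD.setSign_eq]
  by_cases hv : v = 0
  · subst hv
    simp [hD.zero_notMem]
  · by_cases h : v ∈ D <;> simp [h, hv]

lemma setSign_mul_self (hD : IsSkew D) {v : H} (hv : v ≠ 0) : setSign D v * setSign D v = 1 := by
  rw [hD.setSign_eq]
  by_cases h : v ∈ D <;> simp [h, hv]

lemma autocorrelation_setSign_zero (hD : IsSkew D) [Fintype H] :
    autocorrelation (setSign D) 0 = Nat.card H - 1 := by
  classical
  have hsq (x : H) : setSign D x * setSign D x = 1 - if x = 0 then 1 else 0 := by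
    by_cases hx : x = 0
    · simp [hx, setSign_zero]
    · simp [hD.setSign_mul_self hx, hx]
  simp [autocorrelation, hsq]

/-- If `x ∈ D`, then `x + h` lies in the skew set `D + h`, so `-(x + h)` does not; that is,
`-(x + 2h) ∉ D`. -/
lemma subset_of_isSkew_translate (hD : IsSkew D) {h : H} (hD' : IsSkew ((fun d => d + h) '' D)) :
    D ⊆ {x | x ∈ D ∧ x + (h + h) ∈ D} ∪ {-(h + h)} := by
  intro x hx
  by_cases hx0 : x + (h + h) = 0
  · exact Or.inr (eq_neg_of_add_eq_zero_left hx0)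
  have hmem : x + h ∈ (fun d => d + h) '' D := ⟨x, hx, rfl⟩
  have hne : x + h ≠ 0 := fun h' => hD'.zero_notMem (h' ▸ hmem)
  have hneg : -(x + (h + h)) ∉ D := fun h' =>
    (hD'.neg_mem_iff hne).1 ⟨_, h', by simp only; abel⟩ hmem
  exact Or.inl ⟨hx, by rwa [hD.neg_mem_iff hx0, not_not] at hneg⟩

variable [Finite H]

lemma two_mul_ncard (hD : IsSkew D) : 2 * D.ncard + 1 = Nat.card H := by
  have hneg : (-D).ncard = D.ncard := by
    rw [← Set.image_neg_eq_neg, Set.ncard_image_of_injective _ neg_injective]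
  have hunion := Set.ncard_union_eq hD.2
  rw [hD.1, hneg] at hunion
  have hcompl := Set.ncard_add_ncard_compl ({0} : Set H)
  rw [Set.ncard_singleton] at hcompl
  omega

lemma eq_zero_of_add_self (hD : IsSkew D) {h : H} (hh : h + h = 0) : h = 0 := by
  have hcop : (Nat.card H).Coprime 2 :=
    Nat.coprime_two_right.2 ⟨D.ncard, hD.two_mul_ncard.symm⟩
  refine (nsmulCoprime hcop).injective ?_
  simp [two_nsmul, hh]

lemma autocorrelation_setSign (hD : IsSkew D) [Fintype H] {h : H} (hh : h ≠ 0) :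
    autocorrelation (setSign D) h = 4 * {x | x ∈ D ∧ x + h ∈ D}.ncard - Nat.card H + 2 := by
  classical
  set d : H → ℤ := D.indicator 1 with hd
  have hshift : ∑ x, d (x + h) = D.ncard :=
    (Equiv.sum_comp (Equiv.addRight h) d).trans (sum_indicator_one D)
  have hpair : d h + d (-h) = 1 := by
    have := hD.neg_mem_iff hh
    by_cases h' : h ∈ D <;> simp [hd, this, h']
  have hexpand (x : H) : setSign D x * setSign D (x + h) =
      4 * (d x * d (x + h)) - 2 * d x - 2 * d (x + h) + 1 +
        (if x = 0 then 2 * d h - 1 else 0) + (if x = -h then 2 * d (-h) - 1 else 0) := by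
    rw [hD.setSign_eq, hD.setSign_eq, ← hd]
    have hd0 : d 0 = 0 := by simp [hd, hD.zero_notMem]
    by_cases h₁ : x = 0
    · simp [h₁, hh, hd0]
    · by_cases h₂ : x = -h
      · simp [h₂, hh, hd0]
      · simp only [add_eq_zero_iff_eq_neg, h₁, h₂, if_false]
        ring
  have hcard : (Nat.card H : ℤ) = 2 * D.ncard + 1 := by exact_mod_cast hD.two_mul_ncard.symm
  simp only [← autocorrelation_indicator_one, autocorrelation, hexpand, Finset.sum_add_distrib,
    Finset.sum_sub_distrib, ← Finset.mul_sum, hshift, Finset.sum_ite_eq', Finset.mem_univ, if_true]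
  rw [sum_indicator_one, Finset.sum_const, Finset.card_univ, ← Nat.card_eq_fintype_card, hcard]
  simp only [nsmul_eq_mul, hcard]
  linarith

/-- The autocorrelations of the sign function add up to `(∑ v, setSign D v) ^ 2 = 0`, and all but
the one at `0` are equal. -/
lemma four_mul_add_three_of_isDifferenceSet (hD : IsSkew D) [Nontrivial H] {v k l : ℕ}
    (h : IsDifferenceSet D v k l) : 4 * l + 3 = Nat.card H := by
  classical
  have := Fintype.ofFinite H
  have htotal := sum_autocorrelation (setSign D)
  rw [sum_setSign, mul_zero, ← Finset.add_sum_erase _ _ (Finset.mem_univ (0 : H)),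
    hD.autocorrelation_setSign_zero] at htotal
  have hconst : ∀ x ∈ Finset.univ.erase (0 : H), autocorrelation (setSign D) x =
      4 * (l : ℤ) - Nat.card H + 2 := by
    intro x hx
    have hx0 := Finset.ne_of_mem_erase hx
    rw [hD.autocorrelation_setSign hx0, ← ncard_differences, h.2.2 x hx0]
  have hone : 1 < Nat.card H := Finite.one_lt_card
  rw [Finset.sum_congr rfl hconst, Finset.sum_const, Finset.card_erase_of_mem (Finset.mem_univ _),
    Finset.card_univ, ← Nat.card_eq_fintype_card, nsmul_eq_mul, Nat.cast_sub hone.le,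
    Nat.cast_one] at htotal
  have hfactor : ((Nat.card H : ℤ) - 1) * (4 * l + 3 - Nat.card H) = 0 := by linarith
  rcases mul_eq_zero.1 hfactor with h | h <;> omega

lemma isSkewHadamard_iff (hD : IsSkew D) [Fintype H] (hc : Nat.card H % 4 = 3) :
    IsSkewHadamard D ↔ ∀ h : H, h ≠ 0 → autocorrelation (setSign D) h = -1 := by
  constructor
  · rintro ⟨⟨v, k, l, hl⟩, -⟩ x hx
    have : Nontrivial H := ⟨x, 0, hx⟩
    rw [hD.autocorrelation_setSign hx, ← ncard_differences, hl.2.2 x hx,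
      ← hD.four_mul_add_three_of_isDifferenceSet hl]
    push_cast
    ring
  · refine fun h => ⟨⟨Nat.card H, D.ncard, (Nat.card H - 3) / 4, rfl, rfl, fun x hx => ?_⟩, hD⟩
    have hx' := h x hx
    rw [hD.autocorrelation_setSign hx] at hx'
    rw [ncard_differences]
    omega

end IsSkew

namespace IsSkewHadamard

lemma isSkew (hD : IsSkewHadamard D) : IsSkew D := hD.2

lemma image_addEquiv (hD : IsSkewHadamard D) (φ : H ≃+ H) : IsSkewHadamard (φ '' D) := by
  obtain ⟨v, k, l, h⟩ := hD.1
  exact ⟨⟨v, k, l, h.image_addEquiv φ⟩, hD.isSkew.image_addEquiv φ⟩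

variable [Finite H]

lemma four_mul_ncard_add_three (hD : IsSkewHadamard D) {h : H} (hh : h ≠ 0) :
    4 * {x | x ∈ D ∧ x + h ∈ D}.ncard + 3 = Nat.card H := by
  obtain ⟨v, k, l, hl⟩ := hD.1
  have : Nontrivial H := ⟨h, 0, hh⟩
  rw [← ncard_differences, hl.2.2 h hh]
  exact hD.isSkew.four_mul_add_three_of_isDifferenceSet hl

variable (hc : 3 < Nat.card H)
include hc

lemma eq_zero_of_isSkew_translate (hD : IsSkewHadamard D) {h : H}
    (hD' : IsSkew ((fun d => d + h) '' D)) : h = 0 := by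
  by_contra hh
  have hle := (Set.ncard_le_ncard (hD.isSkew.subset_of_isSkew_translate hD')).trans
    (Set.ncard_union_le _ _)
  rw [Set.ncard_singleton] at hle
  have hinter := hD.four_mul_ncard_add_three (mt hD.isSkew.eq_zero_of_add_self hh)
  have hcard := hD.isSkew.two_mul_ncard
  omega

lemma translate_injective (hD : IsSkewHadamard D) :
    Function.Injective fun h : H => (fun d => d + h) '' D := by
  intro h h' (he : (fun d => d + h) '' D = (fun d => d + h') '' D)
  have hfix : (fun d => d + (h - h')) '' D = D := by
    have hcomp := congrArg (fun B => (fun d => d + -h') '' B) he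
    simpa only [Set.image_image, add_assoc, add_neg_cancel, add_zero, Set.image_id',
      sub_eq_add_neg] using hcomp
  exact sub_eq_zero.1 (hD.eq_zero_of_isSkew_translate hc (by rw [hfix]; exact hD.isSkew))

lemma ncard_blocks_through_pair (hD : IsSkewHadamard D) (x y : H) :
    {B ∈ translationDesign D | x ∈ B ∧ y ∈ B}.ncard = {z | z ∈ D ∧ z + (y - x) ∈ D}.ncard := by
  have hblocks : {B ∈ translationDesign D | x ∈ B ∧ y ∈ B} =
      (fun z : H => (fun d => d + (x - z)) '' D) '' {z | z ∈ D ∧ z + (y - x) ∈ D} := by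
    ext B
    simp only [Set.mem_ofPred_eq, Set.mem_image]
    constructor
    · rintro ⟨⟨h, rfl⟩, ⟨d, hd, rfl⟩, e, he, rfl⟩
      exact ⟨d, ⟨hd, by simpa using he⟩, by simp⟩
    · rintro ⟨z, ⟨hz, hz'⟩, rfl⟩
      exact ⟨⟨_, rfl⟩, ⟨z, hz, by simp⟩, _, hz', by simp only; abel⟩
  rw [hblocks, Set.ncard_image_of_injective]
  exact (hD.translate_injective hc).comp sub_right_injective

lemma isSymmetricDesign (hD : IsSkewHadamard D) :
    IsSymmetricDesign (translationDesign D) (Nat.card H) ((Nat.card H - 1) / 2)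
      ((Nat.card H - 3) / 4) where
  card_points := rfl
  card_blocks := by
    have hrange : translationDesign D = Set.range fun h : H => (fun d => d + h) '' D := by
      ext B
      simp only [translationDesign, Set.mem_ofPred_eq, Set.mem_range, eq_comm]
    rw [hrange, ← Set.image_univ, Set.ncard_image_of_injective _ (hD.translate_injective hc),
      Set.ncard_univ]
  card_block := by
    rintro _ ⟨h, rfl⟩
    have hcard := hD.isSkew.two_mul_ncard
    rw [Set.ncard_image_of_injective _ (add_left_injective h)]
    omega
  card_pair := by
    intro x y hxy
    have hcard := hD.four_mul_ncard_add_three (sub_ne_zero.2 hxy.symm)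
    rw [hD.ncard_blocks_through_pair hc]
    omega

lemma eq_of_mem_translationDesign (hD : IsSkewHadamard D) {D' : Set H} (hD' : IsSkew D')
    (h : D' ∈ translationDesign D) : D' = D := by
  obtain ⟨h, rfl⟩ := h
  rw [hD.eq_zero_of_isSkew_translate hc hD']
  simp

lemma injOn_translationDesign : Set.InjOn translationDesign {D : Set H | IsSkewHadamard D} := by
  intro D hD D' hD' h
  refine (hD.eq_of_mem_translationDesign hc hD'.isSkew ?_).symm
  rw [h]
  exact ⟨0, by simp⟩

end IsSkewHadamard

end DifferenceSets

section Automorphisms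

variable {F : Type*} [Field F]

/-- The additive automorphism `(a, b, c) ↦ (k s² τ(a) + m s τ(b) + L(c), k s τ(b) + m τ(c), k τ(c))`
of `F³`; these are the automorphisms normalizing the group `E`. -/
def triangularAut (τ : F ≃+* F) (k s : Fˣ) (m : F) (L : F →+ F) : AutV F :=
  AddEquiv.toIntLinearEquiv
    { toFun v := ![k * s ^ 2 * τ (v 0) + m * s * τ (v 1) + L (v 2), k * s * τ (v 1) + m * τ (v 2),
        k * τ (v 2)]
      invFun w :=
        let c := τ.symm (w 2 / k)
        let b := τ.symm ((w 1 - m * τ c) / (k * s))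
        ![τ.symm ((w 0 - m * s * τ b - L c) / (k * s ^ 2)), b, c]
      left_inv v := by
        ext i; fin_cases i <;> simp [mul_div_cancel_left₀, add_sub_right_comm]
      right_inv w := by
        ext i; fin_cases i <;> simp [mul_div_cancel₀]
        ring
      map_add' v w := by ext i; fin_cases i <;> simp <;> ring }

lemma triangularAut_apply (τ : F ≃+* F) (k s : Fˣ) (m : F) (L : F →+ F) (v : Fin 3 → F) :
    triangularAut τ k s m L v = ![k * s ^ 2 * τ (v 0) + m * s * τ (v 1) + L (v 2),
      k * s * τ (v 1) + m * τ (v 2), k * τ (v 2)] := rfl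

/-- The automorphism `triangularAut τ k s m L` with `L = l τ`; these are the automorphisms
normalizing the group `A`. -/
def semilinearAut (τ : F ≃+* F) (k s : Fˣ) (m l : F) : AutV F :=
  triangularAut τ k s m ((AddMonoidHom.mulLeft l).comp τ.toAddEquiv.toAddMonoidHom)

lemma semilinearAut_apply (τ : F ≃+* F) (k s : Fˣ) (m l : F) (v : Fin 3 → F) :
    semilinearAut τ k s m l v = ![k * s ^ 2 * τ (v 0) + m * s * τ (v 1) + l * τ (v 2),
      k * s * τ (v 1) + m * τ (v 2), k * τ (v 2)] := rfl

lemma semilinearAut_injective {τ τ' : F ≃+* F} {k s k' s' : Fˣ} {m l m' l' : F}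
    (h : semilinearAut τ k s m l = semilinearAut τ' k' s' m' l') :
    τ = τ' ∧ k = k' ∧ s = s' ∧ m = m' ∧ l = l' := by
  have hval (v : Fin 3 → F) (i : Fin 3) :
      semilinearAut τ k s m l v i = semilinearAut τ' k' s' m' l' v i := by rw [h]
  simp only [semilinearAut_apply] at hval
  have hk : k = k' := Units.ext (by simpa using hval ![0, 0, 1] 2)
  have hks : k * s = k' * s' := Units.ext (by simpa using hval ![0, 1, 0] 1)
  refine ⟨RingEquiv.ext fun c => ?_, hk, mul_left_cancel (hk ▸ hks), ?_, ?_⟩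
  · simpa [hk] using hval ![0, 0, c] 2
  · simpa using hval ![0, 0, 1] 1
  · simpa using hval ![0, 0, 1] 0

/-- The automorphism of `F³` with matrix `matE x`. -/
def eAut (x : F) : AutV F := semilinearAut (RingEquiv.refl F) 1 1 x (x ^ 2 / 2)

lemma eAut_apply (x : F) (v : Fin 3 → F) :
    eAut x v = ![v 0 + x * v 1 + x ^ 2 / 2 * v 2, v 1 + x * v 2, v 2] := by
  simp [eAut, semilinearAut_apply]

lemma eAut_apply_eq_mulVec (x : F) (v : Fin 3 → F) : eAut x v = (matE x).mulVec v := by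
  rw [eAut_apply]
  ext i
  fin_cases i <;> simp [matE, Matrix.mulVec, dotProduct, Fin.sum_univ_three]

lemma eAut_injective : Function.Injective (eAut : F → AutV F) := by
  intro x y h
  simpa [eAut_apply] using congrFun (DFunLike.congr_fun h ![0, 0, 1]) 1

/-- The scalar automorphisms of `F³`. -/
def sAut : Fˣ →* AutV F := DistribMulAction.toModuleAut ℤ (Fin 3 → F)

lemma sAut_apply (s : Fˣ) (v : Fin 3 → F) : sAut s v = (s : F) • v := rfl

lemma commute_eAut_sAut (x : F) (s : Fˣ) : Commute (eAut x : AutV F) (sAut s) := by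
  ext v i
  simp only [LinearEquiv.mul_apply, sAut_apply, eAut_apply]
  fin_cases i <;> simp <;> ring

lemma semilinearAut_mul_sAut (τ : F ≃+* F) (k s : Fˣ) (m l : F) (t : Fˣ) :
    semilinearAut τ k s m l * sAut t =
      sAut (Units.map τ.toMonoidHom t) * semilinearAut τ k s m l := by
  ext v i
  simp only [LinearEquiv.mul_apply, semilinearAut_apply, sAut_apply]
  fin_cases i <;> simp <;> ring

variable [NeZero (2 : F)]

lemma triangularAut_mul_eAut (τ : F ≃+* F) (k s : Fˣ) (m : F) (L : F →+ F) (x : F) :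
    triangularAut τ k s m L * eAut x = eAut (s * τ x) * triangularAut τ k s m L := by
  have h2 : (2 : F) ≠ 0 := two_ne_zero
  ext v i
  simp only [LinearEquiv.mul_apply, triangularAut_apply, eAut_apply]
  fin_cases i <;> simp [map_ofNat] <;> field_simp <;> ring

lemma eAut_mul (x y : F) : (eAut x * eAut y : AutV F) = eAut (x + y) := by
  have h2 : (2 : F) ≠ 0 := two_ne_zero
  ext v i
  rw [LinearEquiv.mul_apply]
  fin_cases i <;> simp [eAut_apply] <;> field_simp <;> ring

/-- `eAut` as a homomorphism from the additive group of `F`. -/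
def eHom : Multiplicative F →* AutV F := MonoidHom.mk' (fun x => eAut x.toAdd) fun _ _ =>
  (eAut_mul _ _).symm

lemma eAut_zero : (eAut 0 : AutV F) = 1 := map_one eHom

variable (F) in
lemma groupE_eq_range : groupE F = eHom.range := by
  rw [groupE, ← Subgroup.closure_eq (eHom (F := F)).range]
  congr 1
  ext g
  exact ⟨fun ⟨x, hx⟩ => ⟨.ofAdd x, LinearEquiv.ext fun v =>
    (eAut_apply_eq_mulVec x v).trans (hx v).symm⟩, fun ⟨x, hx⟩ => ⟨x.toAdd, fun v =>
    hx ▸ eAut_apply_eq_mulVec x.toAdd v⟩⟩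

lemma mem_groupE {g : AutV F} : g ∈ groupE F ↔ ∃ x, eAut x = g := by
  rw [groupE_eq_range]
  rfl

omit [NeZero (2 : F)] in
variable (F) in
lemma groupS_eq_map_square : groupS F = (Subgroup.square Fˣ).map sAut := by
  rw [groupS, ← Subgroup.closure_eq ((Subgroup.square Fˣ).map sAut)]
  congr 1
  ext g
  constructor
  · rintro ⟨s, hs, ⟨r, rfl⟩, hg⟩
    have hr : r ≠ 0 := fun h => hs (by simp [h])
    exact ⟨Units.mk0 r hr * Units.mk0 r hr, ⟨_, rfl⟩, LinearEquiv.ext fun v => (hg v).symm⟩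
  · rintro ⟨_, ⟨r, rfl⟩, rfl⟩
    exact ⟨_, (r * r).ne_zero, ⟨r, rfl⟩, fun v => rfl⟩

lemma commute_eHom_sAut (x : Multiplicative F) (s : Subgroup.square Fˣ) :
    Commute (eHom x) (sAut.comp (Subgroup.square Fˣ).subtype s) :=
  commute_eAut_sAut x.toAdd s

/-- The map `(x, s) ↦ E(x) s` exhibiting `A = E × S` as a direct product. -/
def aHom : Multiplicative F × Subgroup.square Fˣ →* AutV F :=
  eHom.noncommCoprod (sAut.comp (Subgroup.square Fˣ).subtype) commute_eHom_sAut

lemma aHom_apply (x : Multiplicative F) (s : Subgroup.square Fˣ) :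
    aHom (x, s) = eAut x.toAdd * sAut (s : Fˣ) := rfl

variable (F) in
lemma groupA_eq_range : groupA F = aHom.range := by
  rw [groupA, groupE_eq_range, groupS_eq_map_square, aHom, MonoidHom.noncommCoprod_range,
    MonoidHom.range_comp, Subgroup.range_subtype]

lemma mem_groupA {g : AutV F} :
    g ∈ groupA F ↔ ∃ (x : F) (s : Fˣ), IsSquare s ∧ eAut x * sAut s = g := by
  rw [groupA_eq_range]
  exact ⟨fun ⟨⟨x, s⟩, h⟩ => ⟨x.toAdd, s, s.2, h⟩, fun ⟨x, s, hs, h⟩ => ⟨(.ofAdd x, ⟨s, hs⟩), h⟩⟩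

lemma aHom_injective : Function.Injective (aHom : _ → AutV F) := by
  rw [injective_iff_map_eq_one]
  rintro ⟨x, s⟩ h
  rw [aHom_apply, LinearEquiv.ext_iff] at h
  have hs : s = 1 := by
    simpa [LinearEquiv.mul_apply, eAut_apply, sAut_apply] using congrFun (h ![0, 0, 1]) 2
  have hx : x = 1 := by
    simpa [LinearEquiv.mul_apply, eAut_apply, sAut_apply, hs] using congrFun (h ![0, 0, 1]) 1
  exact Prod.ext hx hs

omit [NeZero (2 : F)] in
lemma groupE_le_groupA : groupE F ≤ groupA F := le_sup_left

end Automorphisms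

section Normalizer

variable {F : Type*} [Field F]

/-- The entry `(i, j)` of an automorphism of `F³`, regarded as a matrix of additive maps. -/
def entry (φ : AutV F) (i j : Fin 3) : F →+ F :=
  (Pi.evalAddMonoidHom (fun _ => F) i).comp
    (φ.toAddEquiv.toAddMonoidHom.comp (AddMonoidHom.single (fun _ => F) j))

lemma entry_apply (φ : AutV F) (i j : Fin 3) (c : F) : entry φ i j c = φ (Pi.single j c) i := rfl

lemma apply_eq_sum_entry (φ : AutV F) (v : Fin 3 → F) (i : Fin 3) :
    φ v i = entry φ i 0 (v 0) + entry φ i 1 (v 1) + entry φ i 2 (v 2) := by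
  conv_lhs => rw [← Finset.univ_sum_single v, Fin.sum_univ_three, map_add, map_add]
  rfl

/-- `φ` normalizes `E`, by conjugating `E(x)` into `E(σ x)`. -/
def ConjugatesE (φ : AutV F) (σ : F → F) : Prop :=
  ∀ x, φ * eAut x = eAut (σ x) * φ

namespace ConjugatesE

variable {φ : AutV F} {σ : F → F} (h : ConjugatesE φ σ)
include h

lemma apply_eAut (x : F) (v : Fin 3 → F) : φ (eAut x v) = eAut (σ x) (φ v) :=
  DFunLike.congr_fun (h x) v

/-- The columns of the matrix identity `φ (E(x) - 1) = (E(σ x) - 1) φ`. -/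
lemma entry_eq (x c : F) (i : Fin 3) :
    eAut (σ x) (φ (Pi.single 0 c)) i = φ (Pi.single 0 c) i ∧
    eAut (σ x) (φ (Pi.single 1 c)) i = φ (Pi.single 1 c) i + entry φ i 0 (x * c) ∧
    eAut (σ x) (φ (Pi.single 2 c)) i =
      φ (Pi.single 2 c) i + entry φ i 0 (x ^ 2 / 2 * c) + entry φ i 1 (x * c) := by
  simp only [← h.apply_eAut, apply_eq_sum_entry φ, eAut_apply]
  refine ⟨by simp, by simp [add_comm], by simp; abel⟩

variable [NeZero (2 : F)]

lemma apply_one_ne_zero : σ 1 ≠ 0 := by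
  intro h0
  have h1 := h 1
  rw [h0, eAut_zero, one_mul, mul_eq_left, ← eAut_zero] at h1
  exact one_ne_zero (eAut_injective h1)

lemma entry_lower (c : F) : entry φ 1 0 c = 0 ∧ entry φ 2 0 c = 0 ∧ entry φ 2 1 c = 0 := by
  have hσ := h.apply_one_ne_zero
  have h20 (c : F) : entry φ 2 0 c = 0 := by
    simpa [eAut_apply, hσ, ← entry_apply] using (h.entry_eq 1 c 1).1
  have h10 (c : F) : entry φ 1 0 c = 0 := by
    simpa [eAut_apply, hσ, ← entry_apply, h20] using (h.entry_eq 1 c 0).1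
  refine ⟨h10 c, h20 c, ?_⟩
  simpa [eAut_apply, hσ, ← entry_apply, h10] using (h.entry_eq 1 c 1).2.1

lemma entry_zero_zero (x c : F) : entry φ 0 0 (x * c) = σ x * entry φ 1 1 c := by
  simpa [eAut_apply, ← entry_apply, (h.entry_lower c).2.2, eq_comm] using (h.entry_eq x c 0).2.1

lemma entry_one_one (x c : F) : entry φ 1 1 (x * c) = σ x * entry φ 2 2 c := by
  simpa [eAut_apply, ← entry_apply, (h.entry_lower _).1, eq_comm] using (h.entry_eq x c 1).2.2

lemma entry_zero_one (x c : F) : entry φ 0 1 (x * c) = σ x * entry φ 1 2 c := by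
  have h2 : (2 : F) ≠ 0 := two_ne_zero
  have h00 : entry φ 0 0 (x ^ 2 / 2 * c) = σ x ^ 2 / 2 * entry φ 2 2 c := by
    have hhalf : 2 * entry φ 2 2 (c / 2) = entry φ 2 2 c := by
      rw [two_mul, ← map_add, add_halves]
    rw [show x ^ 2 / 2 * c = x * (x * (c / 2)) by ring, h.entry_zero_zero, h.entry_one_one,
      ← hhalf]
    field_simp
  have h02 := (h.entry_eq x c 0).2.2
  simp only [eAut_apply, ← entry_apply, Matrix.cons_val_zero, h00] at h02
  linear_combination -h02

lemma entry_two_two_injective : Function.Injective (entry φ 2 2) := by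
  rw [injective_iff_map_eq_zero]
  intro c hc
  have h11 : entry φ 1 1 c = 0 := by simpa [hc] using h.entry_one_one 1 c
  have h00 : entry φ 0 0 c = 0 := by simpa [h11] using h.entry_zero_zero 1 c
  have hφ : φ (Pi.single 0 c) = 0 := by
    ext i
    fin_cases i
    exacts [h00, (h.entry_lower c).1, (h.entry_lower c).2.1]
  simpa using congrFun ((map_eq_zero_iff φ φ.injective).1 hφ) 0

lemma entry_two_two_surjective : Function.Surjective (entry φ 2 2) := by
  intro c
  obtain ⟨v, hv⟩ := φ.surjective (Pi.single 2 c)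
  have hv2 := congrFun hv 2
  rw [apply_eq_sum_entry, (h.entry_lower _).2.1, (h.entry_lower _).2.2] at hv2
  exact ⟨v 2, by simpa using hv2⟩

lemma entry_two_two_one_ne_zero : entry φ 2 2 1 ≠ 0 := fun h0 =>
  one_ne_zero (h.entry_two_two_injective (h0.trans (map_zero _).symm))

lemma apply_mul_entry (x : F) : σ x * entry φ 2 2 1 = σ 1 * entry φ 2 2 x := by
  rw [← h.entry_one_one, ← h.entry_one_one, one_mul, mul_one]

lemma entry_two_two_mul (x c : F) :
    entry φ 2 2 (x * c) * entry φ 2 2 1 = entry φ 2 2 x * entry φ 2 2 c := by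
  have hxc := h.entry_one_one 1 (x * c)
  rw [one_mul, h.entry_one_one] at hxc
  apply mul_left_cancel₀ h.apply_one_ne_zero
  linear_combination -entry φ 2 2 1 * hxc + entry φ 2 2 c * h.apply_mul_entry x

lemma exists_ringEquiv :
    ∃ τ : F ≃+* F, (∀ c, entry φ 2 2 c = entry φ 2 2 1 * τ c) ∧ ∀ x, σ x = σ 1 * τ x := by
  have hk := h.entry_two_two_one_ne_zero
  have hmul (x c : F) : entry φ 2 2 (x * c) / entry φ 2 2 1 =
      entry φ 2 2 x / entry φ 2 2 1 * (entry φ 2 2 c / entry φ 2 2 1) := by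
    rw [div_mul_div_comm, ← h.entry_two_two_mul, mul_div_mul_right _ _ hk]
  have hadd (x c : F) : entry φ 2 2 (x + c) / entry φ 2 2 1 =
      entry φ 2 2 x / entry φ 2 2 1 + entry φ 2 2 c / entry φ 2 2 1 := by
    rw [map_add, add_div]
  refine ⟨{ Equiv.ofBijective (fun c => entry φ 2 2 c / entry φ 2 2 1)
      ⟨fun x y hxy => h.entry_two_two_injective ((div_left_inj' hk).1 hxy), fun c =>
        (h.entry_two_two_surjective (c * entry φ 2 2 1)).imp fun x hx => by simp [hx, hk]⟩ with
    map_mul' := hmul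
    map_add' := hadd }, fun c => (mul_div_cancel₀ _ hk).symm, fun x => ?_⟩
  apply mul_right_cancel₀ hk
  rw [h.apply_mul_entry, mul_assoc]
  exact congrArg _ (div_mul_cancel₀ _ hk).symm

lemma exists_eq_triangularAut :
    ∃ (τ : F ≃+* F) (k s : Fˣ) (m : F) (L : F →+ F), φ = triangularAut τ k s m L := by
  obtain ⟨τ, h22, hσ⟩ := h.exists_ringEquiv
  have h11 (c : F) : entry φ 1 1 c = σ 1 * (entry φ 2 2 1 * τ c) := by
    rw [← h22, ← h.entry_one_one, one_mul]
  have h00 (c : F) : entry φ 0 0 c = σ 1 * (σ 1 * (entry φ 2 2 1 * τ c)) := by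
    rw [← h11, ← h.entry_zero_zero, one_mul]
  obtain ⟨m, hm⟩ : ∃ m, entry φ 1 2 1 = m := ⟨_, rfl⟩
  have h01 (c : F) : entry φ 0 1 c = σ 1 * τ c * m := by
    rw [← hσ, ← hm, ← h.entry_zero_one, mul_one]
  have h12 (c : F) : entry φ 1 2 c = τ c * m := by
    apply mul_left_cancel₀ h.apply_one_ne_zero
    rw [← mul_assoc, ← h01, ← h.entry_zero_one, one_mul]
  refine ⟨τ, Units.mk0 _ h.entry_two_two_one_ne_zero, Units.mk0 _ h.apply_one_ne_zero,
    m, entry φ 0 2, ?_⟩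
  ext v i
  rw [apply_eq_sum_entry, triangularAut_apply]
  obtain ⟨h10, h20, -⟩ := h.entry_lower (v 0)
  obtain ⟨-, -, h21⟩ := h.entry_lower (v 1)
  fin_cases i
  · simp [h00 (v 0), h01 (v 1)]
    ring
  · simp [h10, h11 (v 1), h12 (v 2)]
    ring
  · simp [h20, h21, h22 (v 2)]

end ConjugatesE

variable [NeZero (2 : F)]

lemma exists_conjugatesE {φ : AutV F} (h : ∀ g ∈ groupE F, φ * g * φ⁻¹ ∈ groupE F) :
    ∃ σ, ConjugatesE φ σ := by
  have hx (x : F) : ∃ y, φ * eAut x = eAut y * φ := by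
    obtain ⟨y, hy⟩ := mem_groupE.1 (h _ (mem_groupE.2 ⟨x, rfl⟩))
    exact ⟨y, by rw [hy, inv_mul_cancel_right]⟩
  choose σ hσ using hx
  exact ⟨σ, hσ⟩

/-- Every `c` is a difference of two squares, so `L` is semilinear as soon as it is so for square
scalars. -/
lemma triangularAut_eq_semilinearAut {τ : F ≃+* F} {k s : Fˣ} {m : F} {L : F →+ F}
    (h : ∀ r, L (r * r) = L 1 * τ (r * r)) :
    triangularAut τ k s m L = semilinearAut τ k s m (L 1) := by
  have h2 : (2 : F) ≠ 0 := two_ne_zero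
  have hL (c : F) : L c = L 1 * τ c := by
    have hc : c = (c + 1) / 2 * ((c + 1) / 2) - (c - 1) / 2 * ((c - 1) / 2) := by
      field_simp
      ring
    rw [hc, map_sub, map_sub, h, h, mul_sub]
  ext v i
  rw [triangularAut_apply, semilinearAut_apply, hL (v 2)]

variable [Finite F]

lemma mem_groupE_of_pow_natCard_eq_one {g : AutV F} (hg : g ∈ groupA F)
    (h : g ^ Nat.card F = 1) : g ∈ groupE F := by
  rw [groupA_eq_range] at hg
  obtain ⟨⟨x, s⟩, rfl⟩ := hg
  rw [← map_pow, map_eq_one_iff _ aHom_injective] at h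
  have hs : (s : Fˣ) ^ Nat.card F = 1 := congrArg (fun y => (y.2 : Fˣ)) h
  rw [← Nat.sub_add_cancel (Nat.card_pos (α := F)), pow_succ, ← Nat.card_units, pow_card_eq_one',
    one_mul] at hs
  exact mem_groupE.2 ⟨x.toAdd, by rw [aHom_apply, hs, map_one, mul_one]⟩

lemma exists_eq_sAut_of_pow_eq_one {g : AutV F} (hg : g ∈ groupA F)
    (h : g ^ (Nat.card F - 1) = 1) : ∃ s, g = sAut s := by
  rw [groupA_eq_range] at hg
  obtain ⟨⟨x, s⟩, rfl⟩ := hg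
  rw [← map_pow, map_eq_one_iff _ aHom_injective] at h
  have hx : x ^ (Nat.card F - 1) = 1 := congrArg Prod.fst h
  have hxq : x ^ Nat.card F = 1 := pow_card_eq_one' (G := Multiplicative F)
  rw [← Nat.sub_add_cancel (Nat.card_pos (α := F)), pow_succ, hx, one_mul] at hxq
  exact ⟨s, by rw [aHom_apply, hxq, toAdd_one, eAut_zero, one_mul]⟩

lemma exists_eq_semilinearAut_of_mem_normalizer {φ : AutV F}
    (h : φ ∈ Subgroup.normalizer (groupA F : Set (AutV F))) :
    ∃ (τ : F ≃+* F) (k s : Fˣ) (m l : F), φ = semilinearAut τ k s m l := by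
  have hconj {g : AutV F} (hg : g ∈ groupA F) : φ * g * φ⁻¹ ∈ groupA F :=
    (Subgroup.mem_normalizer_iff.1 h g).1 hg
  obtain ⟨σ, hσ⟩ := exists_conjugatesE fun g hg => by
    refine mem_groupE_of_pow_natCard_eq_one (hconj (groupE_le_groupA hg)) ?_
    obtain ⟨x, rfl⟩ := mem_groupE.1 hg
    have hx : (eAut x : AutV F) ^ Nat.card F = 1 :=
      (map_pow eHom (Multiplicative.ofAdd x) _).symm.trans
        ((congrArg eHom (pow_card_eq_one' (G := Multiplicative F))).trans (map_one _))
    rw [conj_pow, hx, mul_one, mul_inv_cancel]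
  obtain ⟨τ, k, s, m, L, rfl⟩ := hσ.exists_eq_triangularAut
  refine ⟨τ, k, s, m, L 1, triangularAut_eq_semilinearAut fun r => ?_⟩
  by_cases hr : r = 0
  · simp [hr]
  set u := Units.mk0 r hr with hu
  have hS : sAut (u * u) ∈ groupA F := mem_groupA.2 ⟨0, u * u, ⟨u, rfl⟩, by rw [eAut_zero, one_mul]⟩
  obtain ⟨t, ht⟩ := exists_eq_sAut_of_pow_eq_one (hconj hS) (by
    rw [conj_pow, ← map_pow, ← Nat.card_units, pow_card_eq_one', map_one, mul_one, mul_inv_cancel])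
  have hval (i : Fin 3) := congrFun
    (DFunLike.congr_fun (mul_inv_eq_iff_eq_mul.1 ht) (Pi.single 2 1)) i
  simp only [LinearEquiv.mul_apply, sAut_apply, triangularAut_apply] at hval
  have h2 : τ (r * r) = t := by simpa [hu, mul_comm] using hval 2
  have h0 : L (r * r) = t * L 1 := by simpa [hu] using hval 0
  rw [h0, h2, mul_comm]

lemma mem_normalizer_groupA {φ : AutV F} :
    φ ∈ Subgroup.normalizer (groupA F : Set (AutV F)) ↔
      ∃ (τ : F ≃+* F) (k s : Fˣ) (m l : F), φ = semilinearAut τ k s m l := by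
  refine ⟨exists_eq_semilinearAut_of_mem_normalizer, ?_⟩
  rintro ⟨τ, k, s, m, l, rfl⟩
  have : Finite (AutV F) := DFunLike.finite _
  refine Subgroup.mem_normalizer_fintype fun g hg => ?_
  obtain ⟨x, t, ht, rfl⟩ := mem_groupA.1 hg
  refine mem_groupA.2 ⟨s * τ x, Units.map τ.toMonoidHom t, ht.map _, ?_⟩
  rw [eq_mul_inv_iff_mul_eq, mul_assoc, ← semilinearAut_mul_sAut, ← mul_assoc, ← mul_assoc,
    semilinearAut, triangularAut_mul_eAut]

lemma natCard_normalizer_groupA :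
    Nat.card (Subgroup.normalizer (groupA F : Set (AutV F))) =
      Nat.card (F ≃+* F) * (Nat.card F - 1) ^ 2 * Nat.card F ^ 2 := by
  let f : (F ≃+* F) × Fˣ × Fˣ × F × F → Subgroup.normalizer (groupA F : Set (AutV F)) :=
    fun ⟨τ, k, s, m, l⟩ => ⟨semilinearAut τ k s m l,
      mem_normalizer_groupA.2 ⟨_, _, _, _, _, rfl⟩⟩
  have hf : Function.Bijective f := by
    constructor
    · rintro ⟨τ, k, s, m, l⟩ ⟨τ', k', s', m', l'⟩ h
      obtain ⟨rfl, rfl, rfl, rfl, rfl⟩ := semilinearAut_injective (Subtype.ext_iff.1 h)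
      rfl
    · rintro ⟨φ, hφ⟩
      obtain ⟨τ, k, s, m, l, rfl⟩ := mem_normalizer_groupA.1 hφ
      exact ⟨⟨τ, k, s, m, l⟩, rfl⟩
  rw [← Nat.card_congr (Equiv.ofBijective f hf)]
  simp only [Nat.card_prod, Nat.card_units]
  ring

omit [Finite F] in
variable (F) in
lemma two_mul_natCard_square : 2 * Nat.card (Subgroup.square Fˣ) = Nat.card F - 1 := by
  have hrange : Subgroup.square Fˣ = (powMonoidHom 2 : Fˣ →* Fˣ).range := by
    ext s
    exact ⟨fun ⟨r, hr⟩ => ⟨r, (sq r).trans hr.symm⟩, fun ⟨r, hr⟩ => ⟨r, hr.symm.trans (sq r)⟩⟩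
  have hker : ((powMonoidHom 2 : Fˣ →* Fˣ).ker : Set Fˣ) = {1, -1} := by
    ext s
    simp only [SetLike.mem_coe, MonoidHom.mem_ker, powMonoidHom_apply, Set.mem_insert_iff,
      Set.mem_singleton_iff, Units.ext_iff, Units.val_pow_eq_pow_val, Units.val_one, Units.val_neg]
    exact sq_eq_one_iff
  have hne : (1 : Fˣ) ≠ -1 := fun h => by
    have h1 : (1 : F) = -1 := congrArg Units.val h
    exact two_ne_zero (α := F) (by linear_combination h1)
  have hcard := Subgroup.card_mul_index (powMonoidHom 2 : Fˣ →* Fˣ).ker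
  rwa [Subgroup.index_ker, Nat.card_units, ← SetLike.coe_sort_coe, hker, Nat.card_coe_set_eq,
    Set.ncard_pair hne, ← hrange] at hcard

omit [Finite F] in
variable (F) in
lemma two_mul_natCard_groupA : 2 * Nat.card (groupA F) = (Nat.card F - 1) * Nat.card F := by
  rw [groupA_eq_range, ← Nat.card_congr (MonoidHom.ofInjective aHom_injective).toEquiv,
    Nat.card_prod, ← two_mul_natCard_square F,
    show Nat.card (Multiplicative F) = Nat.card F from rfl]
  ring

variable (F) in
lemma relIndex_groupA :
    (groupA F).relIndex (Subgroup.normalizer (groupA F : Set (AutV F))) =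
      2 * Nat.card (F ≃+* F) * (Nat.card F - 1) * Nat.card F := by
  have hpos : 0 < Nat.card (groupA F) := by
    have := two_mul_natCard_groupA F
    have : 0 < (Nat.card F - 1) * Nat.card F :=
      Nat.mul_pos (Nat.sub_pos_of_lt Finite.one_lt_card) Nat.card_pos
    omega
  have hmul := Subgroup.card_mul_index
    ((groupA F).subgroupOf (Subgroup.normalizer (groupA F : Set (AutV F))))
  rw [natCard_normalizer_groupA, Nat.card_congr
    (Subgroup.subgroupOfEquivOfLe Subgroup.le_normalizer).toEquiv] at hmul
  apply Nat.eq_of_mul_eq_mul_left hpos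
  rw [Subgroup.relIndex, hmul]
  linear_combination Nat.card (F ≃+* F) * (Nat.card F - 1) * Nat.card F *
    (two_mul_natCard_groupA F).symm

omit [NeZero (2 : F)] [Finite F] in
lemma natCard_ringAut {p n : ℕ} (hp : p.Prime) (hF : Nat.card F = p ^ n) :
    Nat.card (F ≃+* F) = n := by
  have : Finite F := Nat.finite_of_card_ne_zero (hF ▸ pow_ne_zero n hp.ne_zero)
  have := Fintype.ofFinite F
  have := Fact.mk hp
  have : CharP F p := charP_of_card_eq_prime_pow (f := n) (by rw [← Nat.card_eq_fintype_card, hF])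
  let _ : Algebra (ZMod p) F := ZMod.algebra F p
  have hrank : p ^ n = p ^ Module.finrank (ZMod p) F := by
    rw [← hF, Nat.card_eq_fintype_card, Module.card_eq_pow_finrank (K := ZMod p), ZMod.card]
  rw [Nat.pow_right_injective hp.two_le hrank, ← IsGalois.card_aut_eq_finrank]
  exact Nat.card_congr
    { toFun f := AlgEquiv.ofRingEquiv (f := f) fun x => DFunLike.congr_fun
        (Subsingleton.elim (f.toRingHom.comp (algebraMap (ZMod p) F)) (algebraMap (ZMod p) F)) x
      invFun f := f.toRingEquiv }

end Normalizer

section InvariantSets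

lemma isSkew_setOf_eq_one {H : Type*} [AddCommGroup H] {f : H → ℤ} (hneg : ∀ v, f (-v) = -f v)
    (hf : ∀ v ≠ 0, f v = 1 ∨ f v = -1) : IsSkew {v | f v = 1} := by
  have h0 : f 0 = 0 := by
    have := hneg 0
    rw [neg_zero] at this
    omega
  constructor
  · ext v
    simp only [Set.mem_union, Set.mem_neg, Set.mem_ofPred_eq, hneg, Set.mem_compl_iff,
      Set.mem_singleton_iff]
    refine ⟨?_, fun hv => (hf v hv).imp_right fun h => by omega⟩
    rintro h rfl
    omega
  · rw [Set.disjoint_left]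
    intro v hv hv'
    simp only [Set.mem_neg, Set.mem_ofPred_eq, hneg] at hv hv'
    omega

lemma setSign_setOf_eq_one {H : Type*} [AddCommGroup H] {f : H → ℤ} (hneg : ∀ v, f (-v) = -f v)
    (hf : ∀ v ≠ 0, f v = 1 ∨ f v = -1) : setSign {v | f v = 1} = f := by
  funext v
  by_cases hv : v = 0
  · have h0 := hneg v
    rw [hv, neg_zero] at h0
    rw [hv, setSign_zero]
    omega
  · rw [(isSkew_setOf_eq_one hneg hf).setSign_eq]
    rcases hf v hv with h | h <;> simp [h, hv]

lemma setSign_image {H H' E : Type*} [AddCommGroup H] [AddCommGroup H'] [EquivLike E H H']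
    [AddEquivClass E H H'] (g : E) (D : Set H) (v : H) : setSign (g '' D) (g v) = setSign D v := by
  have hmem (v : H) : g v ∈ g '' D ↔ v ∈ D := (EquivLike.injective g).mem_set_image
  classical simp only [setSign, Set.indicator_apply, Set.mem_neg, ← map_neg, hmem, Pi.one_apply]

variable {F : Type*} [Field F]

lemma ringChar_ne_two_of_natCard_mod_four [Finite F] (hF : Nat.card F % 4 = 3) :
    ringChar F ≠ 2 := by
  have := Fintype.ofFinite F
  intro h
  have heven := FiniteField.even_card_of_char_two h
  rw [← Nat.card_eq_fintype_card] at heven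
  omega

lemma neZero_two_of_natCard_mod_four [Finite F] (hF : Nat.card F % 4 = 3) : NeZero (2 : F) :=
  ⟨Ring.two_ne_zero (ringChar_ne_two_of_natCard_mod_four hF)⟩

variable [Fintype F] [DecidableEq F]

lemma quadraticChar_neg_one_eq (hF : Nat.card F % 4 = 3) : quadraticChar F (-1) = -1 := by
  rw [quadraticChar_neg_one_iff_not_isSquare, FiniteField.isSquare_neg_one_iff,
    ← Nat.card_eq_fintype_card]
  exact not_not.2 hF

lemma quadraticChar_units_of_isSquare {s : Fˣ} (hs : IsSquare s) : quadraticChar F s = 1 :=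
  (quadraticChar_one_iff_isSquare s.ne_zero).2 (hs.map (Units.coeHom F))

/-- The odd `A`-invariant functions on `F³` with values `±1` away from zero. The orbits of the group
generated by `A` and `-1` on the non-zero vectors are represented by `(1, 0, 0)`, `(0, 1, 0)` and
the vectors `(-t/2, 0, 1)`; the values there are `α`, `β` and `ε t`. -/
def invSign (α β : ℤˣ) (ε : F → ℤˣ) (v : Fin 3 → F) : ℤ :=
  if v 2 ≠ 0 then quadraticChar F (v 2) * ε ((v 1 ^ 2 - 2 * v 0 * v 2) / v 2 ^ 2)
  else if v 1 ≠ 0 then β * quadraticChar F (v 1)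
  else α * quadraticChar F (v 0)

/-- The `A`-invariant skew set with the given signs on the orbits of `A`. -/
def invSet (α β : ℤˣ) (ε : F → ℤˣ) : Set (Fin 3 → F) := {v | invSign α β ε v = 1}

variable {α β : ℤˣ} {ε : F → ℤˣ}

lemma invSign_smul (c : F) (v : Fin 3 → F) :
    invSign α β ε (c • v) = quadraticChar F c * invSign α β ε v := by
  by_cases hc : c = 0
  · simp [hc, invSign]
  have ht : ((c * v 1) ^ 2 - 2 * (c * v 0) * (c * v 2)) / (c * v 2) ^ 2 =
      (v 1 ^ 2 - 2 * v 0 * v 2) / v 2 ^ 2 := by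
    rw [← mul_div_mul_left (v 1 ^ 2 - 2 * v 0 * v 2) (v 2 ^ 2) (pow_ne_zero 2 hc)]
    ring
  simp only [invSign, Pi.smul_apply, smul_eq_mul, ht, map_mul, mul_ne_zero_iff, hc, ne_eq,
    not_false_eq_true, true_and]
  split_ifs <;> ring

lemma invSign_neg (hF : Nat.card F % 4 = 3) (v : Fin 3 → F) :
    invSign α β ε (-v) = -invSign α β ε v := by
  rw [← neg_one_smul F v, invSign_smul, quadraticChar_neg_one_eq hF, neg_one_mul]

lemma invSign_sAut {s : Fˣ} (hs : IsSquare s) (v : Fin 3 → F) :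
    invSign α β ε (sAut s v) = invSign α β ε v := by
  rw [sAut_apply, invSign_smul, quadraticChar_units_of_isSquare hs, one_mul]

lemma invSign_eAut [NeZero (2 : F)] (x : F) (v : Fin 3 → F) :
    invSign α β ε (eAut x v) = invSign α β ε v := by
  have h2 : (2 : F) ≠ 0 := two_ne_zero
  rw [eAut_apply]
  by_cases hc : v 2 = 0
  · by_cases hb : v 1 = 0 <;> simp [invSign, hc, hb]
  · have ht : ((v 1 + x * v 2) ^ 2 - 2 * (v 0 + x * v 1 + x ^ 2 / 2 * v 2) * v 2) / v 2 ^ 2 =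
        (v 1 ^ 2 - 2 * v 0 * v 2) / v 2 ^ 2 := by
      field_simp
      ring
    simp [invSign, hc, ht]

lemma invSign_one_zero_zero : invSign α β ε ![1, 0, 0] = α := by
  simp [invSign]

lemma invSign_zero_one_zero : invSign α β ε ![0, 1, 0] = β := by
  simp [invSign]

lemma invSign_zero_one [NeZero (2 : F)] (t : F) : invSign α β ε ![-t / 2, 0, 1] = ε t := by
  have ht : -(2 * (-t / 2)) = t := by
    have h2 : (2 : F) ≠ 0 := two_ne_zero
    field_simp
  simp [invSign, ht]

lemma invSign_eq_one_or {v : Fin 3 → F} (hv : v ≠ 0) :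
    invSign α β ε v = 1 ∨ invSign α β ε v = -1 := by
  have hmul (u : ℤˣ) {c : F} (hc : c ≠ 0) :
      u * quadraticChar F c = 1 ∨ u * quadraticChar F c = -1 := by
    rcases Int.units_eq_one_or u with rfl | rfl <;>
      rcases quadraticChar_dichotomy hc with h | h <;> rw [h] <;> decide
  unfold invSign
  split_ifs with h2 h1
  · rw [mul_comm]
    exact hmul _ h2
  · exact hmul _ h1
  · refine hmul _ fun h0 => hv ?_
    ext i
    fin_cases i
    exacts [h0, not_not.1 h1, not_not.1 h2]

lemma isSkew_invSet (hF : Nat.card F % 4 = 3) : IsSkew (invSet α β ε) :=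
  isSkew_setOf_eq_one (invSign_neg hF) fun _ => invSign_eq_one_or

lemma setSign_invSet (hF : Nat.card F % 4 = 3) : setSign (invSet α β ε) = invSign α β ε :=
  setSign_setOf_eq_one (invSign_neg hF) fun _ => invSign_eq_one_or

lemma invSet_injective (hF : Nat.card F % 4 = 3) {α' β' : ℤˣ} {ε' : F → ℤˣ}
    (h : invSet α β ε = invSet α' β' ε') : α = α' ∧ β = β' ∧ ε = ε' := by
  have := neZero_two_of_natCard_mod_four hF
  have hsign : invSign α β ε = invSign α' β' ε' := by
    rw [← setSign_invSet hF, h, setSign_invSet hF]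
  refine ⟨Units.ext ?_, Units.ext ?_, funext fun t => Units.ext ?_⟩
  · simpa only [invSign_one_zero_zero] using congrFun hsign ![1, 0, 0]
  · simpa only [invSign_zero_one_zero] using congrFun hsign ![0, 1, 0]
  · simpa only [invSign_zero_one] using congrFun hsign ![-t / 2, 0, 1]

lemma image_invSet [NeZero (2 : F)] {g : AutV F} (hg : g ∈ groupA F) :
    g '' invSet α β ε = invSet α β ε := by
  obtain ⟨x, s, hs, rfl⟩ := mem_groupA.1 hg
  have h (v : Fin 3 → F) : invSign α β ε ((eAut x * sAut s : AutV F) v) = invSign α β ε v := by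
    rw [LinearEquiv.mul_apply, invSign_eAut, invSign_sAut hs]
  rw [LinearEquiv.image_eq_preimage_symm]
  ext v
  change invSign α β ε _ = 1 ↔ invSign α β ε v = 1
  rw [← h, LinearEquiv.apply_symm_apply]

section Classification

variable {f : (Fin 3 → F) → ℤ} (hneg : ∀ v, f (-v) = -f v)
  (hA : ∀ g ∈ groupA F, ∀ v, f (g v) = f v)
include hneg hA

lemma apply_smul_of_odd_of_invariant (hF : Nat.card F % 4 = 3) (c : F) (v : Fin 3 → F) :
    f (c • v) = quadraticChar F c * f v := by
  have := neZero_two_of_natCard_mod_four hF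
  have hsq {c : F} (h : quadraticChar F c = 1) : f (c • v) = f v := by
    have hc : c ≠ 0 := fun h0 => by simp [h0] at h
    obtain ⟨r, rfl⟩ := (quadraticChar_one_iff_isSquare hc).1 h
    set u := Units.mk0 r (mul_self_ne_zero.1 hc)
    exact hA (sAut (u * u)) (mem_groupA.2 ⟨0, u * u, ⟨u, rfl⟩, by rw [eAut_zero, one_mul]⟩) v
  by_cases hc : c = 0
  · have h0 := hneg 0
    rw [neg_zero] at h0
    rw [hc, zero_smul, MulChar.map_zero, zero_mul]
    omega
  rcases quadraticChar_dichotomy hc with h | h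
  · rw [hsq h, h, one_mul]
  · have hchar : quadraticChar F (-c) = 1 := by
      rw [← neg_one_mul, map_mul, h, quadraticChar_neg_one_eq hF]
      rfl
    rw [← neg_neg (c • v), ← neg_smul, hneg, hsq hchar, h, neg_one_mul]

lemma eq_invSign_of_odd_of_invariant (hF : Nat.card F % 4 = 3) (hα : f ![1, 0, 0] = α)
    (hβ : f ![0, 1, 0] = β) (hε : ∀ t, f ![-t / 2, 0, 1] = ε t) : f = invSign α β ε := by
  have := neZero_two_of_natCard_mod_four hF
  have h2 : (2 : F) ≠ 0 := two_ne_zero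
  have hsmul := apply_smul_of_odd_of_invariant hneg hA hF
  have hE (x : F) (v : Fin 3 → F) : f (eAut x v) = f v :=
    hA _ (groupE_le_groupA (mem_groupE.2 ⟨x, rfl⟩)) v
  funext v
  by_cases hc : v 2 = 0
  · by_cases hb : v 1 = 0
    · have hv : v = v 0 • ![1, 0, 0] := by
        ext i
        fin_cases i <;> simp [hc, hb]
      rw [hv, hsmul, invSign_smul, hα, invSign_one_zero_zero]
    · have hv : v = v 1 • eAut (v 0 / v 1) ![0, 1, 0] := by
        rw [eAut_apply]
        ext i
        fin_cases i <;> simp [hc, mul_div_cancel₀ _ hb]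
      rw [hv, hsmul, invSign_smul, hE, invSign_eAut, hβ, invSign_zero_one_zero]
  · have hv : v = v 2 • eAut (v 1 / v 2) ![-((v 1 ^ 2 - 2 * v 0 * v 2) / v 2 ^ 2) / 2, 0, 1] := by
      rw [eAut_apply]
      ext i
      fin_cases i <;> simp <;> field_simp
      ring
    rw [hv, hsmul, invSign_smul, hE, invSign_eAut, hε, invSign_zero_one]

end Classification

lemma exists_eq_invSet (hF : Nat.card F % 4 = 3) {D : Set (Fin 3 → F)} (hD : IsSkew D)
    (hA : ∀ g ∈ groupA F, g '' D = D) : ∃ α β ε, D = invSet α β ε := by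
  have hunit (v : Fin 3 → F) (i : Fin 3) (hi : v i ≠ 0) : ∃ u : ℤˣ, setSign D v = u := by
    have h := hD.setSign_mul_self fun hv => hi (congrFun hv i)
    exact ⟨⟨setSign D v, setSign D v, h, h⟩, rfl⟩
  obtain ⟨α, hα⟩ := hunit ![1, 0, 0] 0 (by simp)
  obtain ⟨β, hβ⟩ := hunit ![0, 1, 0] 1 (by simp)
  choose ε hε using fun t : F => hunit ![-t / 2, 0, 1] 2 (by simp)
  have hsign : setSign D = invSign α β ε :=
    eq_invSign_of_odd_of_invariant (setSign_neg D)
      (fun g hg v => by rw [← setSign_image g D v, hA g hg]) hF hα hβ hε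
  refine ⟨α, β, ε, Set.ext fun v => ?_⟩
  rw [← hD.setSign_eq_one_iff, hsign]
  rfl

end InvariantSets

section Fourier

variable {ι F R : Type*} [Fintype ι] [DecidableEq ι] [Field F] [Fintype F] [CommRing R]
  {ψ : AddChar F R}

/-- The Fourier transform of a function on `F^ι` with respect to the additive character `ψ` of
`F`. -/
def charTransform (ψ : AddChar F R) (f : (ι → F) → R) (y : ι → F) : R :=
  ∑ v, f v * ψ (y ⬝ᵥ v)

lemma charTransform_neg_of_odd {f : (ι → F) → R} (hf : ∀ v, f (-v) = -f v) (y : ι → F) :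
    charTransform ψ f (-y) = -charTransform ψ f y := by
  rw [charTransform, ← Equiv.sum_comp (Equiv.neg _), charTransform, ← Finset.sum_neg_distrib]
  simp [hf]

lemma charTransform_autocorrelation (f : (ι → F) → R) (y : ι → F) :
    charTransform ψ (autocorrelation f) y = charTransform ψ f (-y) * charTransform ψ f y := by
  simp only [charTransform, autocorrelation, Finset.sum_mul]
  rw [Finset.sum_comm]
  refine Finset.sum_congr rfl fun x _ => ?_
  rw [Finset.mul_sum, ← Equiv.sum_comp (Equiv.addLeft x) fun v => f x * ψ (-y ⬝ᵥ x) * _]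
  refine Finset.sum_congr rfl fun h _ => ?_
  rw [Equiv.coe_addLeft, mul_mul_mul_comm, ← AddChar.map_add_eq_mul, neg_dotProduct,
    dotProduct_add, neg_add_cancel_left]

lemma map_autocorrelation {H S : Type*} [AddCommGroup H] [Fintype H] [Semiring S]
    (φ : S →+* R) (f : H → S) (h : H) :
    φ (autocorrelation f h) = autocorrelation (fun x => φ (f x)) h := by
  simp [autocorrelation]

variable [IsDomain R] (hψ : ψ.IsPrimitive)
include hψ

lemma sum_addChar_dotProduct [DecidableEq F] (h : ι → F) :
    ∑ y : ι → F, ψ (y ⬝ᵥ h) = if h = 0 then (Nat.card (ι → F) : R) else 0 := by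
  split_ifs with h0
  · simp [h0]
  · obtain ⟨i, hi⟩ := Function.ne_iff.1 h0
    let φ : AddChar (ι → F) R :=
      ψ.compAddMonoidHom (AddMonoidHom.mk' (· ⬝ᵥ h) fun _ _ => add_dotProduct _ _ _)
    have hφ : φ ≠ 1 := by
      obtain ⟨x, hx⟩ := AddChar.ne_one_iff.1 (hψ hi)
      refine AddChar.ne_one_iff.2 ⟨Pi.single i x, ?_⟩
      change ψ (Pi.single i x ⬝ᵥ h) ≠ 1
      rwa [single_dotProduct, mul_comm]
    exact AddChar.sum_eq_zero_of_ne_one hφ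

lemma charTransform_charTransform (f : (ι → F) → R) (z : ι → F) :
    charTransform ψ (charTransform ψ f) z = Nat.card (ι → F) * f (-z) := by
  classical
  have hpair (v y : ι → F) : f v * ψ (y ⬝ᵥ v) * ψ (z ⬝ᵥ y) = f v * ψ (y ⬝ᵥ (v + z)) := by
    rw [mul_assoc, ← AddChar.map_add_eq_mul, dotProduct_add, dotProduct_comm z]
  simp only [charTransform, Finset.sum_mul, hpair]
  rw [Finset.sum_comm]
  simp only [← Finset.mul_sum, sum_addChar_dotProduct hψ, ← eq_neg_iff_add_eq_zero, mul_ite,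
    mul_zero, Finset.sum_ite_eq', Finset.mem_univ, if_true]
  exact mul_comm _ _

lemma charTransform_ite_sub_one [DecidableEq F] (y : ι → F) :
    charTransform ψ (fun h => (if h = 0 then (Nat.card (ι → F) : R) else 0) - 1) y =
      Nat.card (ι → F) - if y = 0 then (Nat.card (ι → F) : R) else 0 := by
  simp only [charTransform, sub_mul, one_mul, Finset.sum_sub_distrib, ite_mul, zero_mul,
    Finset.sum_ite_eq', Finset.mem_univ, if_true, dotProduct_zero, AddChar.map_zero_eq_one, mul_one]
  simp only [dotProduct_comm y, sum_addChar_dotProduct hψ]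

variable [CharZero R]

lemma charTransform_injective :
    Function.Injective (charTransform ψ : ((ι → F) → R) → (ι → F) → R) := by
  intro f g h
  funext v
  apply mul_left_cancel₀ (Nat.cast_ne_zero.2 Nat.card_pos.ne' : (Nat.card (ι → F) : R) ≠ 0)
  rw [← neg_neg v, ← charTransform_charTransform hψ, h, charTransform_charTransform hψ]

lemma autocorrelation_eq_neg_one_iff {f : (ι → F) → R} (hf : ∀ v, f (-v) = -f v)
    (hf0 : autocorrelation f 0 = Nat.card (ι → F) - 1) :
    (∀ h ≠ 0, autocorrelation f h = -1) ↔
      ∀ y ≠ 0, charTransform ψ f y ^ 2 = -(Nat.card (ι → F) : R) := by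
  classical
  have hzero : charTransform ψ f 0 = 0 := by
    have h := charTransform_neg_of_odd (ψ := ψ) hf 0
    rwa [neg_zero, self_eq_neg] at h
  have hdelta : (∀ h ≠ 0, autocorrelation f h = -1) ↔
      autocorrelation f = fun h => (if h = 0 then (Nat.card (ι → F) : R) else 0) - 1 := by
    refine ⟨fun h => funext fun x => ?_, fun h x hx => by simp [h, hx]⟩
    by_cases hx : x = 0
    · simp [hx, hf0]
    · simp [hx, h x hx]
  rw [hdelta, ← (charTransform_injective hψ).eq_iff, funext_iff]
  refine forall_congr' fun y => ?_
  rw [charTransform_autocorrelation, charTransform_ite_sub_one hψ, charTransform_neg_of_odd hf,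
    neg_mul, ← sq, neg_eq_iff_eq_neg]
  by_cases hy : y = 0 <;> simp [hy, hzero]

end Fourier

section GaussSum

variable {F R : Type*} [Field F] [Fintype F] [DecidableEq F] [CommRing R] {ψ : AddChar F R}

/-- The Gauss sum of the quadratic character and the additive character `ψ`. -/
def quadraticGaussSum (ψ : AddChar F R) : R :=
  gaussSum ((quadraticChar F).ringHomComp (Int.castRingHom R)) ψ

lemma quadraticGaussSum_sq [IsDomain R] [CharZero R] (hF : Nat.card F % 4 = 3)
    (hψ : ψ.IsPrimitive) : quadraticGaussSum ψ ^ 2 = -(Nat.card F : R) := by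
  have hne : (quadraticChar F).ringHomComp (Int.castRingHom R) ≠ 1 :=
    (MulChar.ringHomComp_ne_one_iff Int.cast_injective).2
      (quadraticChar_ne_one (ringChar_ne_two_of_natCard_mod_four hF))
  rw [quadraticGaussSum, gaussSum_sq hne ((quadraticChar_isQuadratic F).comp _) hψ,
    MulChar.ringHomComp_apply, quadraticChar_neg_one_eq hF]
  simp

lemma sum_quadraticChar_mul_addChar (hF : ringChar F ≠ 2) (z : F) :
    ∑ c, (quadraticChar F c : R) * ψ (c * z) = quadraticGaussSum ψ * quadraticChar F z := by
  by_cases hz : z = 0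
  · have hsum : ∑ c, (quadraticChar F c : R) = 0 := by
      exact_mod_cast congrArg (Int.cast : ℤ → R) (quadraticChar_sum_zero hF)
    simpa [hz] using hsum
  · have hshift := gaussSum_mulShift ((quadraticChar F).ringHomComp (Int.castRingHom R)) ψ
      (Units.mk0 z hz)
    have hsq : (quadraticChar F z : R) ^ 2 = 1 := by
      exact_mod_cast congrArg (Int.cast : ℤ → R) (quadraticChar_sq_one hz)
    rw [quadraticGaussSum, ← hshift]
    simp only [gaussSum, AddChar.mulShift_apply, MulChar.ringHomComp_apply, Units.val_mk0,
      mul_comm z, eq_intCast]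
    linear_combination (-∑ c, (quadraticChar F c : R) * ψ (c * z)) * hsq

lemma sum_comp_sq (hF : ringChar F ≠ 2) (g : F → ℤ) :
    ∑ y, g (y ^ 2) = ∑ x, (quadraticChar F x + 1) * g x := by
  rw [← Finset.sum_fiberwise Finset.univ (fun y : F => y ^ 2) (fun y => g (y ^ 2))]
  refine Finset.sum_congr rfl fun x _ => ?_
  rw [Finset.sum_congr rfl fun y hy => congrArg g (Finset.mem_filter.1 hy).2, Finset.sum_const,
    nsmul_eq_mul, ← quadraticChar_card_sqrts hF x]
  congr 3
  ext y
  simp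

lemma sum_quadraticChar_mul_quadraticChar_sub (hF : ringChar F ≠ 2) {s : F} (hs : s ≠ 0) :
    ∑ x, quadraticChar F x * quadraticChar F (x - s) = -1 := by
  have hjacobi := jacobiSum_nontrivial_inv (quadraticChar_ne_one hF)
  rw [(quadraticChar_isQuadratic F).inv, jacobiSum] at hjacobi
  have hscale (x : F) : quadraticChar F (s * x) * quadraticChar F (s * x - s) =
      quadraticChar F (-1) * (quadraticChar F x * quadraticChar F (1 - x)) := by
    rw [show s * x - s = s * (-1 * (1 - x)) by ring, map_mul, map_mul, map_mul]
    linear_combination (quadraticChar F (-1) * quadraticChar F x * quadraticChar F (1 - x)) *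
      quadraticChar_sq_one hs
  rw [← Equiv.sum_comp (Equiv.mulLeft₀ s hs)]
  simp only [Equiv.mulLeft₀_apply, hscale]
  rw [← Finset.mul_sum, hjacobi]
  linear_combination -quadraticChar_sq_one (neg_ne_zero.2 (one_ne_zero (α := F)))

lemma sum_quadraticChar_sq_sub (hF : ringChar F ≠ 2) (s : F) :
    ∑ y, quadraticChar F (y ^ 2 - s) = (if s = 0 then (Nat.card F : ℤ) else 0) - 1 := by
  have hshift : ∑ x, quadraticChar F (x - s) = 0 :=
    (Equiv.sum_comp (Equiv.subRight s) _).trans (quadraticChar_sum_zero hF)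
  rw [sum_comp_sq hF fun x => quadraticChar F (x - s)]
  simp only [add_mul, one_mul, Finset.sum_add_distrib, hshift, add_zero]
  split_ifs with hs
  · have hsq (x : F) :
        quadraticChar F x * quadraticChar F (x - s) = 1 - if x = 0 then 1 else 0 := by
      by_cases hx : x = 0
      · simp [hx]
      · rw [hs, sub_zero, ← sq, quadraticChar_sq_one hx, if_neg hx, sub_zero]
    simp only [hsq, Finset.sum_sub_distrib]
    simp
  · rw [sum_quadraticChar_mul_quadraticChar_sub hF hs, zero_sub]

end GaussSum

section TransformOfInvSign

lemma sum_fin_three {X M : Type*} [Fintype X] [AddCommMonoid M] (g : (Fin 3 → X) → M) :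
    ∑ v, g v = ∑ c, ∑ b, ∑ a, g ![a, b, c] := by
  let e : X × X × X ≃ (Fin 3 → X) :=
    { toFun := fun x => ![x.2.2, x.2.1, x.1]
      invFun := fun v => (v 2, v 1, v 0)
      left_inv := fun x => rfl
      right_inv := fun v => by ext i; fin_cases i <;> rfl }
  rw [← Equiv.sum_comp e, Fintype.sum_prod_type]
  simp only [Fintype.sum_prod_type]
  rfl

variable {F R : Type*} [Field F] [Fintype F] [DecidableEq F] [CommRing R] {ψ : AddChar F R}
  (α β : ℤˣ) (ε : F → ℤˣ)

/-- The integer `J` such that the Fourier transform of `invSign α β ε` at `y` is `J` times the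
quadratic Gauss sum. -/
noncomputable def transformCoeff (y : Fin 3 → F) : ℤ :=
  ∑ t, (ε t : ℤ) * ∑ b, quadraticChar F (y 0 * ((b ^ 2 - t) / 2) + y 1 * b + y 2) +
    (if y 0 = 0 then Nat.card F * (β * quadraticChar F (y 1) : ℤ) else 0) +
    α * quadraticChar F (y 0)

lemma sum_plane_invSign_mul_addChar [NeZero (2 : F)] {c : F} (hc : c ≠ 0) (y : Fin 3 → F) :
    ∑ b, ∑ a, (invSign α β ε ![a, b, c] : R) * ψ (y ⬝ᵥ ![a, b, c]) =
      ∑ t, ∑ b, ε t * (quadraticChar F c *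
        ψ (c * (y 0 * ((b ^ 2 - t) / 2) + y 1 * b + y 2))) := by
  have h2 : (2 : F) ≠ 0 := two_ne_zero
  rw [Finset.sum_comm (γ := F) (f := fun t b => (ε t : R) * (quadraticChar F c *
    ψ (c * (y 0 * ((b ^ 2 - t) / 2) + y 1 * b + y 2))))]
  -- On the plane, `(a, b, c)` is `c • (a', b', 1)` and `a'` is parametrised by `t = b' ^ 2 - 2 a'`.
  refine (Fintype.sum_equiv (Equiv.mulLeft₀ c hc) _ _ fun b => ?_).symm
  let e : F ≃ F :=
    { toFun := fun t => c * ((b ^ 2 - t) / 2)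
      invFun := fun a => b ^ 2 - 2 * a / c
      left_inv := fun t => by field_simp; ring
      right_inv := fun a => by field_simp; ring }
  refine Fintype.sum_equiv e _ _ fun t => ?_
  have ht : ((c * b) ^ 2 - 2 * (c * ((b ^ 2 - t) / 2)) * c) / c ^ 2 = t := by
    field_simp
    ring
  have hdot : y ⬝ᵥ ![c * ((b ^ 2 - t) / 2), c * b, c] =
      c * (y 0 * ((b ^ 2 - t) / 2) + y 1 * b + y 2) := by
    simp only [dotProduct, Fin.sum_univ_three, Matrix.cons_val]
    ring
  have hsign : invSign α β ε ![c * ((b ^ 2 - t) / 2), c * b, c] = quadraticChar F c * ε t := by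
    simp [invSign, hc, ht]
  rw [Equiv.mulLeft₀_apply, Equiv.coe_fn_mk, hdot, hsign]
  push_cast
  ring

lemma sum_plane_zero_invSign_mul_addChar [IsDomain R] (hF : ringChar F ≠ 2) (hψ : ψ.IsPrimitive)
    (y : Fin 3 → F) :
    ∑ b, ∑ a, (invSign α β ε ![a, b, 0] : R) * ψ (y ⬝ᵥ ![a, b, 0]) =
      quadraticGaussSum ψ *
        ((if y 0 = 0 then Nat.card F * (β * quadraticChar F (y 1) : R) else 0) +
          α * quadraticChar F (y 0)) := by
  have hsplit (b a : F) : (invSign α β ε ![a, b, 0] : R) * ψ (y ⬝ᵥ ![a, b, 0]) =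
      β * (quadraticChar F b * ψ (b * y 1)) * ψ (a * y 0) +
        if b = 0 then α * (quadraticChar F a * ψ (a * y 0)) else 0 := by
    have hdot : y ⬝ᵥ ![a, b, 0] = a * y 0 + b * y 1 := by
      simp [dotProduct, Fin.sum_univ_three, mul_comm]
    rw [hdot, AddChar.map_add_eq_mul]
    by_cases hb : b = 0
    · simp [invSign, hb, mul_assoc, -quadraticChar_apply, quadraticChar_zero]
    · simp [invSign, hb, -quadraticChar_apply]
      ring
  have hψsum : ∑ a, ψ (a * y 0) = if y 0 = 0 then (Nat.card F : R) else 0 := by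
    rw [AddChar.sum_mulShift _ hψ]
    simp
  simp only [hsplit, Finset.sum_add_distrib, ← Finset.mul_sum, ← Finset.sum_mul, hψsum,
    sum_quadraticChar_mul_addChar hF, Finset.sum_ite_irrel, Finset.sum_const_zero,
    Finset.sum_ite_eq', Finset.mem_univ, if_true]
  split_ifs <;> ring

lemma charTransform_invSign [IsDomain R] (hF : ringChar F ≠ 2) (hψ : ψ.IsPrimitive)
    (y : Fin 3 → F) : charTransform ψ (fun v => (invSign α β ε v : R)) y =
      quadraticGaussSum ψ * transformCoeff α β ε y := by
  have : NeZero (2 : F) := ⟨Ring.two_ne_zero hF⟩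
  set g : F → F → F → R := fun c t b =>
    ε t * (quadraticChar F c * ψ (c * (y 0 * ((b ^ 2 - t) / 2) + y 1 * b + y 2))) with hg
  have hplanes : ∑ c, ∑ t, ∑ b, g c t b = quadraticGaussSum ψ * ∑ t, ε t *
      ∑ b, (quadraticChar F (y 0 * ((b ^ 2 - t) / 2) + y 1 * b + y 2) : R) := by
    rw [Finset.sum_comm, Finset.mul_sum]
    refine Finset.sum_congr rfl fun t _ => ?_
    rw [Finset.sum_comm]
    simp only [hg, ← Finset.mul_sum, sum_quadraticChar_mul_addChar hF]
    ring
  have hzero : ∑ t, ∑ b, g 0 t b = 0 := by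
    simp [hg]
  have hne : ∑ c ∈ Finset.univ.erase (0 : F), ∑ b, ∑ a,
      (invSign α β ε ![a, b, c] : R) * ψ (y ⬝ᵥ ![a, b, c]) = ∑ c, ∑ t, ∑ b, g c t b := by
    rw [← Finset.add_sum_erase _ (fun c => ∑ t, ∑ b, g c t b) (Finset.mem_univ 0), hzero, zero_add]
    exact Finset.sum_congr rfl fun c hc =>
      sum_plane_invSign_mul_addChar α β ε (Finset.ne_of_mem_erase hc) y
  rw [charTransform, sum_fin_three, ← Finset.add_sum_erase _ _ (Finset.mem_univ 0), hne, hplanes,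
    sum_plane_zero_invSign_mul_addChar α β ε hF hψ, transformCoeff]
  push_cast
  ring

variable {y : Fin 3 → F}

lemma transformCoeff_of_apply_zero_ne_zero (hF : ringChar F ≠ 2) (hy : y 0 ≠ 0) :
    transformCoeff α β ε y = quadraticChar F (y 0) * (quadraticChar F 2 *
      (Nat.card F * ε (2 * y 2 / y 0 - y 1 ^ 2 / y 0 ^ 2) - ∑ t, (ε t : ℤ)) + α) := by
  have h2 : (2 : F) ≠ 0 := Ring.two_ne_zero hF
  set t₀ := 2 * y 2 / y 0 - y 1 ^ 2 / y 0 ^ 2 with ht₀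
  -- Completing the square reduces the inner sum to the one of `sum_quadraticChar_sq_sub`.
  have hinner (t : F) : ∑ b, quadraticChar F (y 0 * ((b ^ 2 - t) / 2) + y 1 * b + y 2) =
      quadraticChar F (y 0) * quadraticChar F 2 *
        ((if t = t₀ then (Nat.card F : ℤ) else 0) - 1) := by
    have hsum := sum_quadraticChar_sq_sub hF (t - t₀)
    simp only [sub_eq_zero] at hsum
    rw [← hsum, Finset.mul_sum]
    refine Fintype.sum_equiv (Equiv.addRight (y 1 / y 0)) _ _ fun b => ?_
    have hsq : y 0 * ((b ^ 2 - t) / 2) + y 1 * b + y 2 =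
        y 0 * 2 * (2⁻¹ ^ 2 * ((b + y 1 / y 0) ^ 2 - (t - t₀))) := by
      rw [ht₀]
      field_simp
      ring
    rw [hsq, map_mul, map_mul, map_mul, quadraticChar_sq_one' (inv_ne_zero h2), one_mul]
    rfl
  have hterm (t : F) : (ε t : ℤ) * (quadraticChar F (y 0) * quadraticChar F 2 *
        ((if t = t₀ then (Nat.card F : ℤ) else 0) - 1)) =
      quadraticChar F (y 0) * quadraticChar F 2 *
        ((if t = t₀ then (Nat.card F : ℤ) * ε t else 0) - ε t) := by
    split_ifs <;> ring
  simp only [transformCoeff, hinner, hterm, if_neg hy, ← Finset.mul_sum, Finset.sum_sub_distrib,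
    Finset.sum_ite_eq', Finset.mem_univ, if_true]
  ring

lemma transformCoeff_of_apply_one_ne_zero (hF : ringChar F ≠ 2) (hy0 : y 0 = 0) (hy : y 1 ≠ 0) :
    transformCoeff α β ε y = Nat.card F * (β * quadraticChar F (y 1) : ℤ) := by
  have hinner : ∑ b, quadraticChar F (y 1 * b + y 2) = 0 :=
    (Equiv.sum_comp ((Equiv.mulLeft₀ (y 1) hy).trans (Equiv.addRight (y 2))) _).trans
      (quadraticChar_sum_zero hF)
  simp only [transformCoeff, hy0, zero_mul, zero_add, hinner, mul_zero, Finset.sum_const_zero,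
    if_true, quadraticChar_zero, add_zero]

lemma transformCoeff_of_apply_eq_zero (hy0 : y 0 = 0) (hy1 : y 1 = 0) :
    transformCoeff α β ε y = Nat.card F * quadraticChar F (y 2) * ∑ t, (ε t : ℤ) := by
  simp only [transformCoeff, hy0, hy1, zero_mul, zero_add, Finset.sum_const, quadraticChar_zero,
    mul_zero, ite_self, add_zero, Finset.card_univ, ← Nat.card_eq_fintype_card, nsmul_eq_mul,
    ← Finset.sum_mul]
  ring

end TransformOfInvSign

section Counting

lemma sum_units_eq_of_forall_sq_eq {X : Type*} [Fintype X] [Nontrivial X] {ε : X → ℤˣ} {δ : ℤˣ}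
    (h : ∀ t, (Fintype.card X * (ε t : ℤ) + (δ - ∑ t, (ε t : ℤ))) ^ 2 = (Fintype.card X : ℤ) ^ 2) :
    ∑ t, (ε t : ℤ) = δ := by
  by_contra hne
  set q : ℤ := (Fintype.card X : ℤ)
  have hq : 1 < q := Nat.one_lt_cast.2 Fintype.one_lt_card
  have hK (t : X) : δ - ∑ t, (ε t : ℤ) = -2 * q * ε t := by
    refine mul_left_cancel₀ (sub_ne_zero.2 (Ne.symm hne)) ?_
    linear_combination h t - q ^ 2 * Int.isUnit_sq (ε t).isUnit
  have hsum : ∑ t, (ε t : ℤ) = -δ := by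
    have hsum := Finset.sum_congr (rfl : Finset.univ = Finset.univ) fun t _ => hK t
    rw [Finset.sum_const, ← Finset.mul_sum, Finset.card_univ, nsmul_eq_mul] at hsum
    refine mul_left_cancel₀ (by positivity : q ≠ 0) ?_
    linear_combination hsum
  obtain ⟨t⟩ : Nonempty X := inferInstance
  have hδ : (δ : ℤ) = -(q * ε t) := by
    linarith [hK t]
  have hsq : (1 : ℤ) = q ^ 2 := by
    rw [← Int.isUnit_sq δ.isUnit, hδ, neg_sq, mul_pow, Int.isUnit_sq (ε t).isUnit, mul_one]
  nlinarith

variable {F : Type*} [Field F] [Fintype F] [DecidableEq F] {α β : ℤˣ} {ε : F → ℤˣ}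

lemma forall_transformCoeff_sq_eq_iff (hF : ringChar F ≠ 2) :
    (∀ y ≠ 0, transformCoeff α β ε y ^ 2 = (Nat.card F : ℤ) ^ 2) ↔
      ∑ t, (ε t : ℤ) = quadraticChar F 2 * α := by
  have h2 : (2 : F) ≠ 0 := Ring.two_ne_zero hF
  have hη := quadraticChar_sq_one h2
  have hu (u : ℤˣ) : (u : ℤ) ^ 2 = 1 := Int.isUnit_sq u.isUnit
  constructor
  · intro h
    let η : ℤˣ := ⟨quadraticChar F 2, quadraticChar F 2, sq (quadraticChar F 2) ▸ hη,
      sq (quadraticChar F 2) ▸ hη⟩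
    refine (sum_units_eq_of_forall_sq_eq (δ := η * α) fun t => ?_).trans (Units.val_mul _ _)
    have ht := h ![1, 0, t / 2] fun h0 => one_ne_zero (congrFun h0 0)
    rw [transformCoeff_of_apply_zero_ne_zero _ _ _ hF (by simp)] at ht
    simp only [Matrix.cons_val, map_one, div_one, mul_div_cancel₀ t h2, one_pow, one_mul,
      zero_pow two_ne_zero, sub_zero] at ht
    rw [← Nat.card_eq_fintype_card, ← ht, Units.val_mul]
    generalize ∑ t, (ε t : ℤ) = s
    change (Nat.card F * (ε t : ℤ) + (quadraticChar F 2 * α - s)) ^ 2 = _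
    linear_combination (α ^ 2 - (Nat.card F * ε t - s : ℤ) ^ 2) * hη
  · intro h y hy
    by_cases hy0 : y 0 = 0
    · by_cases hy1 : y 1 = 0
      · have hy2 : y 2 ≠ 0 := fun hy2 => hy (by ext i; fin_cases i <;> assumption)
        rw [transformCoeff_of_apply_eq_zero _ _ _ hy0 hy1, h]
        simp only [mul_pow, quadraticChar_sq_one hy2, hη, hu, mul_one]
      · rw [transformCoeff_of_apply_one_ne_zero _ _ _ hF hy0 hy1]
        simp only [mul_pow, quadraticChar_sq_one hy1, hu, mul_one]
    · rw [transformCoeff_of_apply_zero_ne_zero _ _ _ hF hy0, h]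
      have hcancel (e : ℤ) : quadraticChar F 2 * (Nat.card F * e - quadraticChar F 2 * α) + α =
          quadraticChar F 2 * (Nat.card F * e) := by
        linear_combination -(α : ℤ) * hη
      rw [hcancel]
      simp only [mul_pow, quadraticChar_sq_one hy0, hη, hu, mul_one, one_mul]

lemma natCard_fin_three {X : Type*} : Nat.card (Fin 3 → X) = Nat.card X ^ 3 := by
  rw [Nat.card_fun, Nat.card_fin]

lemma natCard_fin_three_mod_four {X : Type*} (hX : Nat.card X % 4 = 3) :
    Nat.card (Fin 3 → X) % 4 = 3 := by
  rw [natCard_fin_three, Nat.pow_mod, hX]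

lemma isSkewHadamard_invSet_iff (hF : Nat.card F % 4 = 3) :
    IsSkewHadamard (invSet α β ε) ↔ ∑ t, (ε t : ℤ) = quadraticChar F 2 * α := by
  obtain ⟨ψ, hψ1⟩ := AddChar.exists_apply_ne_zero.2 (one_ne_zero (α := F))
  have hψ : ψ.IsPrimitive := AddChar.IsPrimitive.of_ne_one (AddChar.ne_one_iff.2 ⟨1, hψ1⟩)
  have hq : (Nat.card F : ℂ) ≠ 0 := Nat.cast_ne_zero.2 Nat.card_pos.ne'
  have hF2 := ringChar_ne_two_of_natCard_mod_four hF
  have hskew : IsSkew (invSet α β ε) := isSkew_invSet hF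
  have hcast (h : Fin 3 → F) : ((autocorrelation (invSign α β ε) h : ℤ) : ℂ) =
      autocorrelation (fun v => (invSign α β ε v : ℂ)) h :=
    map_autocorrelation (Int.castRingHom ℂ) _ h
  have hzero : autocorrelation (invSign α β ε) 0 = Nat.card (Fin 3 → F) - 1 := by
    rw [← setSign_invSet hF, hskew.autocorrelation_setSign_zero]
  have hcoeff (y : Fin 3 → F) :
      charTransform ψ (fun v => (invSign α β ε v : ℂ)) y ^ 2 = -(Nat.card (Fin 3 → F) : ℂ) ↔
        transformCoeff α β ε y ^ 2 = (Nat.card F : ℤ) ^ 2 := by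
    rw [charTransform_invSign α β ε hF2 hψ, mul_pow, quadraticGaussSum_sq hF hψ, neg_mul, neg_inj,
      natCard_fin_three, Nat.cast_pow, pow_succ' _ 2, mul_right_inj' hq]
    norm_cast
  rw [hskew.isSkewHadamard_iff (natCard_fin_three_mod_four hF), setSign_invSet hF,
    ← forall_transformCoeff_sq_eq_iff (β := β) hF2]
  simp only [← hcoeff]
  rw [← autocorrelation_eq_neg_one_iff hψ]
  · simp only [← hcast]
    norm_cast
  · exact fun v => by rw [invSign_neg hF, Int.cast_neg]
  · rw [← hcast, hzero]
    push_cast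
    rfl

lemma sum_units_eq_two_mul_card_sub {X : Type*} [Fintype X] (ε : X → ℤˣ) :
    ∑ t, (ε t : ℤ) = 2 * (Finset.univ.filter fun t => ε t = 1).card - Fintype.card X := by
  have hε (t : X) : (ε t : ℤ) = 2 * (if ε t = 1 then 1 else 0) - 1 := by
    rcases Int.units_eq_one_or (ε t) with h | h <;> simp [h]
  rw [Finset.sum_congr rfl fun t _ => hε t, Finset.sum_sub_distrib, ← Finset.mul_sum,
    Finset.sum_boole]
  simp

/-- Sign functions correspond to the sets on which they are positive. -/
def signFunctionEquivFinset (X : Type*) [Fintype X] [DecidableEq X] : (X → ℤˣ) ≃ Finset X where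
  toFun ε := Finset.univ.filter fun t => ε t = 1
  invFun s t := if t ∈ s then 1 else -1
  left_inv ε := by
    ext t
    rcases Int.units_eq_one_or (ε t) with h | h <;> simp [h]
  right_inv s := by
    ext t
    simp

lemma natCard_signs_sum_eq {X : Type*} [Fintype X] (hX : Odd (Fintype.card X)) (δ : ℤˣ) :
    Nat.card {ε : X → ℤˣ // ∑ t, (ε t : ℤ) = δ} =
      (Fintype.card X).choose ((Fintype.card X + 1) / 2) := by
  classical
  obtain ⟨r, hr⟩ := hX
  set k := if δ = 1 then r + 1 else r with hk
  have hcard (ε : X → ℤˣ) : ∑ t, (ε t : ℤ) = δ ↔ (signFunctionEquivFinset X ε).card = k := by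
    rw [sum_units_eq_two_mul_card_sub, signFunctionEquivFinset, Equiv.coe_fn_mk, hr, hk]
    rcases Int.units_eq_one_or δ with rfl | rfl <;> simp <;> omega
  rw [Nat.card_congr ((signFunctionEquivFinset X).subtypeEquiv
    (q := fun s : Finset X => s.card = k) hcard), Nat.card_eq_fintype_card,
    Fintype.card_finset_len, hr, show (2 * r + 1 + 1) / 2 = r + 1 by omega]
  rcases Int.units_eq_one_or δ with rfl | rfl
  · simp [hk]
  · simp [hk, Nat.choose_symm_half]

omit [Fintype F] [DecidableEq F] in
lemma ncard_invariantSHDS [Finite F] (hF : Nat.card F % 4 = 3) :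
    (invariantSHDS F).ncard = 4 * (Nat.card F).choose ((Nat.card F + 1) / 2) := by
  classical
  have := Fintype.ofFinite F
  have := neZero_two_of_natCard_mod_four hF
  obtain ⟨η, hη⟩ : ∃ η : ℤˣ, quadraticChar F 2 = η := by
    rcases quadraticChar_dichotomy (two_ne_zero (α := F)) with h | h
    exacts [⟨1, h⟩, ⟨-1, h⟩]
  let f : (Σ x : ℤˣ × ℤˣ, {ε : F → ℤˣ // ∑ t, (ε t : ℤ) = (η * x.1 : ℤˣ)}) → invariantSHDS F :=
    fun x => ⟨invSet x.1.1 x.1.2 x.2.1,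
      (isSkewHadamard_invSet_iff hF).2 (by rw [x.2.2, hη, Units.val_mul]),
      fun g hg => image_invSet hg⟩
  have hf : Function.Bijective f := by
    constructor
    · rintro ⟨⟨α, β⟩, ε, hε⟩ ⟨⟨α', β'⟩, ε', hε'⟩ h
      obtain ⟨rfl, rfl, rfl⟩ := invSet_injective hF (Subtype.ext_iff.1 h)
      rfl
    · rintro ⟨D, hD, hA⟩
      obtain ⟨α, β, ε, rfl⟩ := exists_eq_invSet hF hD.isSkew hA
      have hsum := (isSkewHadamard_invSet_iff hF).1 hD
      exact ⟨⟨⟨α, β⟩, ε, by rw [hsum, hη, Units.val_mul]⟩, rfl⟩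
  have hodd : Odd (Fintype.card F) := by
    rw [← Nat.card_eq_fintype_card, Nat.odd_iff]
    omega
  rw [← Nat.card_coe_set_eq, ← Nat.card_congr (Equiv.ofBijective f hf), Nat.card_sigma]
  simp only [natCard_signs_sum_eq hodd, Finset.sum_const, Finset.card_univ,
    Nat.card_eq_fintype_card]
  rfl

end Counting

section ConjugatePSubgroups

variable {G : Type*} [Group G]

lemma relIndex_le_natCard {H K : Subgroup G} {X : Type*} [Finite X] (f : K → X)
    (hf : ∀ a b : K, f a = f b → (a : G)⁻¹ * b ∈ H) : H.relIndex K ≤ Nat.card X := by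
  refine Nat.card_le_card_of_injective (fun x : K ⧸ H.subgroupOf K => f x.out) fun x y hxy => ?_
  rw [← QuotientGroup.out_eq' x, ← QuotientGroup.out_eq' y, QuotientGroup.eq,
    Subgroup.mem_subgroupOf]
  exact hf _ _ hxy

lemma natCard_le_natCard_inf_mul_relIndex [Finite G] {H K R : Subgroup G} (hK : K ≤ R) :
    Nat.card K ≤ Nat.card (H ⊓ K : Subgroup G) * H.relIndex R :=
  calc Nat.card K = Nat.card (H ⊓ K : Subgroup G) * H.relIndex K := by
        simpa only [Subgroup.relIndex_bot_left, Subgroup.inf_relIndex_right] using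
          (Subgroup.relIndex_mul_relIndex ⊥ (H ⊓ K) K bot_le inf_le_right).symm
    _ ≤ Nat.card (H ⊓ K : Subgroup G) * H.relIndex R :=
        Nat.mul_le_mul_left _
          (Subgroup.relIndex_le_of_le_right hK Subgroup.index_ne_zero_of_finite)

lemma natCard_conj_smul (g : G) (H : Subgroup G) : Nat.card ↥(MulAut.conj g • H) = Nat.card H :=
  (Nat.card_congr (H.equivSMul (MulAut.conj g)).toEquiv).symm

lemma mem_normalizer_iff_conj_smul_eq {H : Subgroup G} {g : G} :
    g ∈ Subgroup.normalizer (H : Set G) ↔ MulAut.conj g • H = H :=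
  Subgroup.mem_normalizer_iff_map_conj_eq

variable [Finite G] {p : ℕ} [Fact p.Prime] {P : Subgroup G}

/-- Normalizers grow in `Q`: an element of `Q` normalizing `Q ∩ N(P)` maps `P` into it. -/
lemma le_normalizer_of_isPGroup {Q : Subgroup G} (hQ : IsPGroup p Q) (hPQ : P ≤ Q)
    (h : ∀ g : G, MulAut.conj g • P ≤ Q ⊓ Subgroup.normalizer (P : Set G) → MulAut.conj g • P = P) :
    Q ≤ Subgroup.normalizer (P : Set G) := by
  set R := Q ⊓ Subgroup.normalizer (P : Set G)
  have hPR : P ≤ R := le_inf hPQ Subgroup.le_normalizer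
  suffices R.subgroupOf Q = ⊤ from (Subgroup.subgroupOf_eq_top.1 this).trans inf_le_right
  have := hQ.isNilpotent
  by_contra hne
  obtain ⟨y, hy, hyR⟩ := SetLike.exists_of_lt
    (Group.normalizerCondition_of_isNilpotent (G := Q) _ (lt_top_iff_ne_top.2 hne))
  refine hyR (Subgroup.mem_subgroupOf.2 ⟨y.2, mem_normalizer_iff_conj_smul_eq.2 (h y ?_)⟩)
  rintro _ ⟨z, hz, rfl⟩
  exact (Subgroup.mem_normalizer_iff.1 hy ⟨z, hPQ hz⟩).1 (hPR hz)

lemma exists_mul_mem_normalizer {S : Subgroup G} (hPS : P ≤ S) (hP : IsPGroup p P)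
    (h : ∀ R : Subgroup G, P ≤ R → R ≤ S → R ≤ Subgroup.normalizer (P : Set G) → IsPGroup p R →
      ∀ g : G, MulAut.conj g • P ≤ R → MulAut.conj g • P = P)
    {g : G} (hg : MulAut.conj g • P ≤ S) :
    ∃ x ∈ S, x * g ∈ Subgroup.normalizer (P : Set G) := by
  obtain ⟨Q, hQ⟩ := (hP.comap_of_injective S.subtype S.subtype_injective).exists_le_sylow
  obtain ⟨Q₂, hQ₂⟩ := ((hP.map (MulAut.conj g).toMonoidHom).comap_of_injective S.subtype
    S.subtype_injective).exists_le_sylow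
  set Q' : Subgroup G := Q.toSubgroup.map S.subtype
  have hQS : Q' ≤ S := Subgroup.map_subtype_le _
  have hPQ : P ≤ Q' := fun y hy => ⟨⟨y, hPS hy⟩, hQ hy, rfl⟩
  have hQp : IsPGroup p Q' := Q.isPGroup'.map _
  have hnorm : Q' ≤ Subgroup.normalizer (P : Set G) :=
    le_normalizer_of_isPGroup hQp hPQ <| h _ (le_inf hPQ Subgroup.le_normalizer)
      (inf_le_left.trans hQS) inf_le_right (hQp.to_le inf_le_left)
  obtain ⟨x, hx⟩ := MulAction.exists_smul_eq S Q₂ Q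
  refine ⟨x, x.2, mem_normalizer_iff_conj_smul_eq.2 (h Q' hPQ hQS hnorm hQp _ ?_)⟩
  rintro _ ⟨z, hz, rfl⟩
  have hz' : MulAut.conj g z ∈ MulAut.conj g • P := ⟨z, hz, rfl⟩
  have hxz : x * ⟨_, hg hz'⟩ * x⁻¹ ∈ Q := hx ▸ ⟨⟨_, hg hz'⟩, hQ₂ hz', rfl⟩
  exact ⟨_, hxz, by simp [mul_assoc]⟩

end ConjugatePSubgroups

section SemilinearFixedPoints

variable {F : Type*} [Field F] [Finite F]

lemma sq_natCard_fixed_le {τ : F ≃+* F} (hτ : τ ≠ RingEquiv.refl F) :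
    Nat.card {c : F // τ c = c} ^ 2 ≤ Nat.card F := by
  obtain ⟨y, hy⟩ : ∃ y, τ y ≠ y := by
    by_contra! h
    exact hτ (RingEquiv.ext h)
  rw [sq, ← Nat.card_prod]
  refine Nat.card_le_card_of_injective (fun x => x.1.1 + x.2.1 * y) ?_
  rintro ⟨⟨u, hu⟩, v, hv⟩ ⟨⟨u', hu'⟩, v', hv'⟩ (h : u + v * y = u' + v' * y)
  have hτh := congrArg τ h
  simp only [map_add, map_mul, hu, hv, hu', hv'] at hτh
  have hvv' : (v - v') * (τ y - y) = 0 := by linear_combination hτh - h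
  obtain rfl : v = v' := sub_eq_zero.1 ((mul_eq_zero.1 hvv').resolve_right (sub_ne_zero.2 hy))
  obtain rfl : u = u' := add_right_cancel h
  rfl

/-- Fixed vectors of a `τ`-semilinear map have `τ`-fixed coordinates with respect to linearly
independent fixed vectors. -/
lemma natCard_fixed_le_of_semilinear {V : Type*} [AddCommGroup V] [Module F V] [Module.Finite F V]
    {τ : F →+* F} (φ : V →ₛₗ[τ] V) :
    Nat.card {v // φ v = v} ≤ Nat.card {c // τ c = c} ^ Module.finrank F V := by
  obtain ⟨b, hbφ, hspan, hb⟩ := exists_linearIndependent F {v | φ v = v}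
  have : Finite b := hb.finite
  have := Fintype.ofFinite b
  have hcoord (v : {v // φ v = v}) : ∃ c : b → F, ∑ i, c i • (i : V) = v := by
    rw [← Submodule.mem_span_range_iff_exists_fun, Subtype.range_coe, hspan]
    exact Submodule.subset_span v.2
  choose c hc using hcoord
  have hτ (v : {v // φ v = v}) (i : b) : τ (c v i) = c v i := by
    have h : ∑ i, τ (c v i) • (i : V) = ∑ i, c v i • (i : V) :=
      calc ∑ i, τ (c v i) • (i : V) = φ (∑ i, c v i • (i : V)) := by
            rw [map_sum]
            exact Finset.sum_congr rfl fun i _ => by rw [map_smulₛₗ, hbφ i.2]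
        _ = ∑ i, c v i • (i : V) := by rw [hc, v.2]
    exact congrFun (hb.fintypeLinearCombination_injective h) i
  calc Nat.card {v // φ v = v} ≤ Nat.card (b → {c // τ c = c}) := by
        refine Nat.card_le_card_of_injective (fun v i => ⟨c v i, hτ v i⟩) fun v w hvw => ?_
        have hcvw : c v = c w := funext fun i => Subtype.ext_iff.1 (congrFun hvw i)
        rw [Subtype.ext_iff, ← hc v, ← hc w, hcvw]
    _ = Nat.card {c // τ c = c} ^ Nat.card b := Nat.card_fun
    _ ≤ _ := by
        have : Nonempty {c // τ c = c} := ⟨0, map_zero τ⟩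
        refine Nat.pow_le_pow_right Nat.card_pos ?_
        rw [Nat.card_eq_fintype_card]
        exact hb.fintype_card_le_finrank

lemma natCard_fixed_eAut_le {x : F} (hx : x ≠ 0) :
    Nat.card {v : Fin 3 → F // eAut x v = v} ≤ Nat.card F := by
  have hfix (v : {v : Fin 3 → F // eAut x v = v}) : v.1 2 = 0 ∧ v.1 1 = 0 := by
    have hv := v.2
    rw [eAut_apply] at hv
    have h1 : v.1 1 + x * v.1 2 = v.1 1 := congrFun hv 1
    have h0 : v.1 0 + x * v.1 1 + x ^ 2 / 2 * v.1 2 = v.1 0 := congrFun hv 0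
    have hv2 : v.1 2 = 0 := by simpa [hx] using h1
    exact ⟨hv2, by simpa [hx, hv2] using h0⟩
  refine Nat.card_le_card_of_injective (fun v => v.1 0) fun v w h => Subtype.ext ?_
  ext i
  fin_cases i
  · exact h
  · exact (hfix v).2.trans (hfix w).2.symm
  · exact (hfix v).1.trans (hfix w).1.symm

end SemilinearFixedPoints

section AffinePermutations

variable {V : Type*} [AddCommGroup V]

/-- The group of the affine permutations `v ↦ φ v + h` of an abelian group `V` with linear part `φ`
in `Γ`. The translations are `affinePerm ⊥`. -/
def affinePerm (Γ : Subgroup (V ≃ₗ[ℤ] V)) : Subgroup (Equiv.Perm V) where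
  carrier := {g | ∃ φ ∈ Γ, ∃ h, ∀ v, g v = φ v + h}
  one_mem' := ⟨1, Γ.one_mem, 0, fun v => by simp⟩
  mul_mem' := by
    rintro a b ⟨φ, hφ, h, ha⟩ ⟨χ, hχ, k, hb⟩
    refine ⟨φ * χ, Γ.mul_mem hφ hχ, φ k + h, fun v => ?_⟩
    rw [Equiv.Perm.mul_apply, ha, hb, map_add, LinearEquiv.mul_apply, add_assoc]
  inv_mem' := by
    rintro a ⟨φ, hφ, h, ha⟩
    refine ⟨φ⁻¹, Γ.inv_mem hφ, -(φ⁻¹ h), fun v => ?_⟩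
    rw [Equiv.Perm.inv_eq_iff_eq, ha, map_add, map_neg, ← LinearEquiv.mul_apply,
      ← LinearEquiv.mul_apply]
    simp

lemma mem_affinePerm_bot {g : Equiv.Perm V} : g ∈ affinePerm ⊥ ↔ ∃ h, ∀ v, g v = v + h :=
  ⟨fun ⟨_, hφ, h, hg⟩ => ⟨h, by cases Subgroup.mem_bot.1 hφ; exact hg⟩,
    fun ⟨h, hg⟩ => ⟨1, Subgroup.mem_bot.2 rfl, h, hg⟩⟩

lemma addRight_mem_affinePerm (Γ : Subgroup (V ≃ₗ[ℤ] V)) (h : V) :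
    Equiv.addRight h ∈ affinePerm Γ :=
  ⟨1, Γ.one_mem, h, fun _ => rfl⟩

lemma affinePerm_mono {Γ Δ : Subgroup (V ≃ₗ[ℤ] V)} (h : Γ ≤ Δ) : affinePerm Γ ≤ affinePerm Δ :=
  fun _ ⟨φ, hφ, k, hg⟩ => ⟨φ, h hφ, k, hg⟩

lemma linearPart_unique {φ χ : V ≃ₗ[ℤ] V} {h k : V} (H : ∀ v, φ v + h = χ v + k) :
    φ = χ ∧ h = k := by
  have h0 : h = k := by simpa using H 0
  exact ⟨LinearEquiv.ext fun v => add_right_cancel (h0 ▸ H v), h0⟩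

/-- The embedding of the automorphisms of an abelian group into its permutations. -/
def linPerm : (V ≃ₗ[ℤ] V) →* Equiv.Perm V where
  toFun φ := φ.toEquiv
  map_one' := rfl
  map_mul' _ _ := rfl

lemma linPerm_apply (φ : V ≃ₗ[ℤ] V) (v : V) : linPerm φ v = φ v := rfl

lemma linPerm_mem_affinePerm_iff {Γ : Subgroup (V ≃ₗ[ℤ] V)} {φ : V ≃ₗ[ℤ] V} :
    linPerm φ ∈ affinePerm Γ ↔ φ ∈ Γ := by
  constructor
  · rintro ⟨χ, hχ, h, hφ⟩
    have hφχ : φ = χ := (linearPart_unique (h := 0) (k := h) fun v => by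
      rw [add_zero, ← hφ, linPerm_apply]).1
    exact hφχ ▸ hχ
  · exact fun hφ => ⟨φ, hφ, 0, fun v => (add_zero _).symm⟩

lemma affinePerm_le_affinePerm_iff {Γ Δ : Subgroup (V ≃ₗ[ℤ] V)} :
    affinePerm Γ ≤ affinePerm Δ ↔ Γ ≤ Δ :=
  ⟨fun h _ hφ => linPerm_mem_affinePerm_iff.1 (h (linPerm_mem_affinePerm_iff.2 hφ)),
    affinePerm_mono⟩

lemma affinePerm_injective : Function.Injective (affinePerm (V := V)) := fun _ _ h =>
  le_antisymm (affinePerm_le_affinePerm_iff.1 h.le) (affinePerm_le_affinePerm_iff.1 h.ge)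

lemma eq_addRight_mul_linPerm {g : Equiv.Perm V} {φ : V ≃ₗ[ℤ] V} {h : V}
    (hg : ∀ v, g v = φ v + h) : g = Equiv.addRight h * linPerm φ :=
  Equiv.ext hg

lemma linPerm_mem_of_mem {R : Subgroup (Equiv.Perm V)} (hR : affinePerm ⊥ ≤ R) {r : Equiv.Perm V}
    (hr : r ∈ R) {φ : V ≃ₗ[ℤ] V} {h : V} (hφ : ∀ v, r v = φ v + h) : linPerm φ ∈ R := by
  rw [eq_addRight_mul_linPerm hφ] at hr
  exact (R.mul_mem_cancel_left (hR (addRight_mem_affinePerm ⊥ h))).1 hr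

lemma le_affinePerm_comap_linPerm {R : Subgroup (Equiv.Perm V)} (hR : affinePerm ⊥ ≤ R)
    (haff : ∀ r ∈ R, ∃ (φ : V ≃ₗ[ℤ] V) (h : V), ∀ v, r v = φ v + h) :
    R ≤ affinePerm (R.comap linPerm) := by
  intro r hr
  obtain ⟨φ, h, hφ⟩ := haff r hr
  exact ⟨φ, linPerm_mem_of_mem hR hr hφ, h, hφ⟩

lemma conj_smul_affinePerm (Γ : Subgroup (V ≃ₗ[ℤ] V)) {w : Equiv.Perm V} {φ : V ≃ₗ[ℤ] V} {h : V}
    (hw : ∀ v, w v = φ v + h) :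
    MulAut.conj w • affinePerm Γ = affinePerm (MulAut.conj φ • Γ) := by
  have key (χ : V ≃ₗ[ℤ] V) (k v : V) :
      φ (χ v + k) + h = (φ * χ * φ⁻¹) (w v) + (φ k + h - (φ * χ * φ⁻¹) h) := by
    rw [hw, map_add, map_add, ← LinearEquiv.mul_apply (φ * χ * φ⁻¹) φ, inv_mul_cancel_right,
      LinearEquiv.mul_apply φ χ]
    abel
  ext g
  constructor
  · rintro ⟨r, ⟨χ, hχ, k, hr⟩, rfl⟩
    refine ⟨φ * χ * φ⁻¹, ⟨χ, hχ, rfl⟩, φ k + h - (φ * χ * φ⁻¹) h, fun v => ?_⟩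
    obtain ⟨v, rfl⟩ := w.surjective v
    rw [← key, ← hr, ← hw]
    simp
  · rintro ⟨_, ⟨χ, hχ, rfl⟩, k, hg⟩
    refine ⟨w⁻¹ * g * w, ⟨χ, hχ, φ⁻¹ (k - h + (φ * χ * φ⁻¹) h), fun v => ?_⟩, ?_⟩
    · rw [Equiv.Perm.mul_apply, Equiv.Perm.mul_apply, Equiv.Perm.inv_eq_iff_eq, hw (_ + _), key, hg,
        ← LinearEquiv.mul_apply φ φ⁻¹, mul_inv_cancel, LinearEquiv.coe_one, id_eq]
      change (φ * χ * φ⁻¹) (w v) + k = _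
      abel
    · simp [mul_assoc]

lemma natCard_affinePerm (Γ : Subgroup (V ≃ₗ[ℤ] V)) :
    Nat.card (affinePerm Γ) = Nat.card Γ * Nat.card V := by
  rw [← Nat.card_prod]
  refine (Nat.card_congr (Equiv.ofBijective (fun x : Γ × V =>
    (⟨Equiv.addRight x.2 * linPerm x.1.1, x.1.1, x.1.2, x.2, fun _ => rfl⟩ : affinePerm Γ))
    ⟨?_, ?_⟩)).symm
  · rintro ⟨⟨φ, hφ⟩, h⟩ ⟨⟨χ, hχ⟩, k⟩ H
    obtain ⟨rfl, rfl⟩ := linearPart_unique fun v => DFunLike.congr_fun (Subtype.ext_iff.1 H) v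
    rfl
  · rintro ⟨g, φ, hφ, h, hg⟩
    exact ⟨⟨⟨φ, hφ⟩, h⟩, Subtype.ext (eq_addRight_mul_linPerm hg).symm⟩

lemma mul_comm_of_mem_conj_smul_affinePerm_bot (w : Equiv.Perm V) :
    ∀ a ∈ MulAut.conj w • affinePerm (⊥ : Subgroup (V ≃ₗ[ℤ] V)),
    ∀ b ∈ MulAut.conj w • affinePerm (⊥ : Subgroup (V ≃ₗ[ℤ] V)), a * b = b * a := by
  rintro _ ⟨a, ha, rfl⟩ _ ⟨b, hb, rfl⟩
  obtain ⟨h, ha⟩ := mem_affinePerm_bot.1 ha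
  obtain ⟨k, hb⟩ := mem_affinePerm_bot.1 hb
  have hab : a * b = b * a := Equiv.ext fun v => by
    rw [Equiv.Perm.mul_apply, Equiv.Perm.mul_apply, ha, hb, ha, hb, add_right_comm]
  exact (map_mul (MulAut.conj w) a b).symm.trans
    ((congrArg (MulAut.conj w) hab).trans (map_mul (MulAut.conj w) b a))

variable [Finite V]

instance finite_intLinearEquiv : Finite (V ≃ₗ[ℤ] V) := DFunLike.finite _

lemma relIndex_affinePerm_bot (Γ : Subgroup (V ≃ₗ[ℤ] V)) :
    (affinePerm ⊥).relIndex (affinePerm Γ) = Nat.card Γ := by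
  have h := Subgroup.relIndex_mul_relIndex ⊥ _ _ bot_le (affinePerm_mono (bot_le (a := Γ)))
  rw [Subgroup.relIndex_bot_left, Subgroup.relIndex_bot_left, natCard_affinePerm,
    natCard_affinePerm, Subgroup.card_bot, one_mul, mul_comm] at h
  exact Nat.eq_of_mul_eq_mul_right Nat.card_pos h

lemma exists_affine_of_conj_smul_le {w : Equiv.Perm V}
    (hw : MulAut.conj w • affinePerm (⊥ : Subgroup (V ≃ₗ[ℤ] V)) ≤ affinePerm ⊥) :
    ∃ (φ : V ≃ₗ[ℤ] V) (h : V), ∀ v, w v = φ v + h := by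
  have hadd (v h : V) : w (v + h) = w v + (w h - w 0) := by
    obtain ⟨k, hk⟩ := mem_affinePerm_bot.1 (hw ⟨_, addRight_mem_affinePerm ⊥ h, rfl⟩)
    have hwk (v : V) : w (v + h) = w v + k := by simpa using hk (w v)
    have hw0 := hwk 0
    rw [zero_add] at hw0
    rw [hwk, hw0, add_sub_cancel_left]
  let f : V →+ V :=
    { toFun v := w v - w 0
      map_zero' := sub_self _
      map_add' v h := by rw [hadd]; abel }
  have hinj : Function.Injective f := fun v v' h => w.injective (sub_left_injective h)
  exact ⟨LinearEquiv.ofBijective f.toIntLinearMap ⟨hinj, Finite.injective_iff_surjective.1 hinj⟩,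
    w 0, fun v => (sub_add_cancel (w v) (w 0)).symm⟩

/-- The translations in `W` commute with any `r ∈ W`, so they are translations by fixed points of
the linear part of `r`. -/
lemma le_affinePerm_bot_of_comm {Γ : Subgroup (V ≃ₗ[ℤ] V)} {W : Subgroup (Equiv.Perm V)}
    (hW : W ≤ affinePerm Γ) (hcomm : ∀ a ∈ W, ∀ b ∈ W, a * b = b * a)
    (hcard : Nat.card W = Nat.card V)
    (hfix : ∀ φ ∈ Γ, φ ≠ 1 → Nat.card {v // φ v = v} * Nat.card Γ < Nat.card V) :
    W ≤ affinePerm ⊥ := by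
  intro r hr
  obtain ⟨φ, hφ, h, hrφ⟩ := hW hr
  by_contra hrT
  have hφ1 : φ ≠ 1 := by
    rintro rfl
    exact hrT (mem_affinePerm_bot.2 ⟨h, hrφ⟩)
  have hle : Nat.card (affinePerm ⊥ ⊓ W :) ≤ Nat.card {v // φ v = v} := by
    have htrans (t : (affinePerm ⊥ ⊓ W :)) : ∀ v, t.1 v = v + t.1 0 := by
      obtain ⟨k, hk⟩ := mem_affinePerm_bot.1 t.2.1
      intro v
      rw [hk, hk, zero_add]
    have hfixed (t : (affinePerm ⊥ ⊓ W :)) : φ (t.1 0) = t.1 0 := by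
      have h0 := DFunLike.congr_fun (hcomm r hr t.1 t.2.2) 0
      rw [Equiv.Perm.mul_apply, Equiv.Perm.mul_apply, htrans t (r 0), hrφ, hrφ, map_zero φ,
        zero_add, add_comm h] at h0
      exact add_right_cancel h0
    refine Nat.card_le_card_of_injective (fun t => ⟨t.1 0, hfixed t⟩) fun t t' htt' => ?_
    refine Subtype.ext (Equiv.ext fun v => ?_)
    have h0 : t.1 0 = t'.1 0 := Subtype.ext_iff.1 htt'
    rw [htrans t, htrans t', h0]
  refine (hfix φ hφ hφ1).not_ge ?_
  calc Nat.card V = Nat.card W := hcard.symm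
    _ ≤ Nat.card (affinePerm ⊥ ⊓ W :) * (affinePerm ⊥).relIndex (affinePerm Γ) :=
        natCard_le_natCard_inf_mul_relIndex hW
    _ ≤ Nat.card {v // φ v = v} * Nat.card Γ :=
        Nat.mul_le_mul hle (relIndex_affinePerm_bot Γ).le

lemma exists_affine_of_conj_smul_le_affinePerm {Γ : Subgroup (V ≃ₗ[ℤ] V)} {w : Equiv.Perm V}
    (hw : MulAut.conj w • affinePerm (⊥ : Subgroup (V ≃ₗ[ℤ] V)) ≤ affinePerm Γ)
    (hfix : ∀ φ ∈ Γ, φ ≠ 1 → Nat.card {v // φ v = v} * Nat.card Γ < Nat.card V) :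
    ∃ (φ : V ≃ₗ[ℤ] V) (h : V), ∀ v, w v = φ v + h := by
  refine exists_affine_of_conj_smul_le (le_affinePerm_bot_of_comm hw
    (mul_comm_of_mem_conj_smul_affinePerm_bot w) ?_ hfix)
  rw [natCard_conj_smul, natCard_affinePerm, Subgroup.card_bot, one_mul]

end AffinePermutations

section Isomorphism

lemma dvd_card_filter_of_period {H : Type*} [AddCommGroup H] [Fintype H] {p : ℕ} (hp : p.Prime)
    {d : H} (hpd : p • d = 0) (hd : d ≠ 0) (P : H → Prop) [DecidablePred P]
    (hP : ∀ t, P (t + d) ↔ P t) : p ∣ (Finset.univ.filter P).card := by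
  classical
  have := Fact.mk hp
  let σ : Equiv.Perm {t // P t} := (Equiv.addRight d).subtypePerm hP
  have hiterate (i : ℕ) (t : {t // P t}) : ((σ ^ i) t : H) = t + i • d := by
    induction i with
    | zero => simp
    | succ i ih =>
      rw [pow_succ', Equiv.Perm.mul_apply, succ_nsmul, ← add_assoc, ← ih]
      rfl
  have hpow : σ ^ p ^ 1 = 1 := by
    ext t
    rw [pow_one, hiterate, hpd, add_zero, Equiv.Perm.one_apply]
  have hsupport : σ.supportᶜ = ∅ := by
    rw [Finset.compl_eq_empty_iff, Finset.eq_univ_iff_forall]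
    intro t
    rw [Equiv.Perm.mem_support]
    exact fun ht => hd (left_eq_add.1 (Subtype.ext_iff.1 ht).symm)
  have hmod := Equiv.Perm.card_compl_support_modEq hpow
  rw [hsupport, Finset.card_empty, Fintype.card_subtype] at hmod
  exact (Nat.modEq_zero_iff_dvd).1 hmod.symm

lemma eq_zero_of_period {F : Type*} [Field F] [Fintype F] {ε : F → ℤˣ} {u : ℤˣ}
    (hε : ∑ t, (ε t : ℤ) = u) {d : F} (hd : ∀ t, ε (t + d) = ε t) : d = 0 := by
  by_contra hd0
  have hp : (ringChar F).Prime := CharP.char_is_prime F _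
  have hcard : ringChar F ∣ Fintype.card F := (ringChar.spec F _).1 (Nat.cast_card_eq_zero F)
  have hplus : ringChar F ∣ (Finset.univ.filter fun t => ε t = 1).card :=
    dvd_card_filter_of_period hp (by rw [nsmul_eq_mul, CharP.cast_eq_zero, zero_mul]) hd0 _
      fun t => by rw [hd]
  have hu : (ringChar F : ℤ) ∣ u := by
    rw [← hε, sum_units_eq_two_mul_card_sub]
    exact dvd_sub ((Int.natCast_dvd_natCast.2 hplus).mul_left _) (Int.natCast_dvd_natCast.2 hcard)
  exact hp.not_isUnit (Int.ofNat_isUnit.1 (isUnit_of_dvd_unit hu u.isUnit))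

variable {F : Type*} [Field F] [Fintype F] [DecidableEq F]

lemma quadraticChar_ringEquiv (τ : F ≃+* F) (x : F) :
    quadraticChar F (τ x) = quadraticChar F x := by
  have hsq : IsSquare (τ x) ↔ IsSquare x :=
    ⟨fun h => by simpa using h.map τ.symm, fun h => h.map τ⟩
  simp only [quadraticChar_apply, quadraticCharFun, hsq, map_eq_zero_iff τ τ.injective]

variable {α β α' β' : ℤˣ} {ε ε' : F → ℤˣ} {τ : F ≃+* F} {k s : Fˣ} {m : F}

lemma sign_eq_of_image {L : F →+ F} (hF : Nat.card F % 4 = 3)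
    (h : triangularAut τ k s m L '' invSet α β ε = invSet α' β' ε') {c : F} (hc : c ≠ 0) (t : F) :
    (ε' (m ^ 2 / k ^ 2 + s ^ 2 * τ t - 2 * L c / (k * τ c)) : ℤ) = quadraticChar F k * ε t := by
  have := neZero_two_of_natCard_mod_four hF
  have h2 : (2 : F) ≠ 0 := two_ne_zero
  have hk := k.ne_zero
  have hτc : τ c ≠ 0 := (map_ne_zero_iff τ τ.injective).2 hc
  have hsource : invSign α β ε ![-(t * c) / 2, 0, c] = quadraticChar F c * ε t := by
    have ht : ((0 : F) ^ 2 - 2 * (-(t * c) / 2) * c) / c ^ 2 = t := by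
      field_simp
      ring
    simp only [invSign, Matrix.cons_val, ne_eq, hc, not_false_eq_true, if_true, ht]
  have htarget : invSign α' β' ε' (triangularAut τ k s m L ![-(t * c) / 2, 0, c]) =
      quadraticChar F k * quadraticChar F c *
        ε' (m ^ 2 / k ^ 2 + s ^ 2 * τ t - 2 * L c / (k * τ c)) := by
    have ht : ((k * s * τ 0 + m * τ c) ^ 2 -
        2 * (k * s ^ 2 * τ (-(t * c) / 2) + m * s * τ 0 + L c) * (k * τ c)) / (k * τ c) ^ 2 =
          m ^ 2 / k ^ 2 + s ^ 2 * τ t - 2 * L c / (k * τ c) := by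
      simp only [map_div₀, map_neg, map_mul, map_ofNat, map_zero]
      field_simp
      ring
    simp only [invSign, triangularAut_apply, Matrix.cons_val, ne_eq, mul_ne_zero hk hτc,
      not_false_eq_true, if_true, ht, map_mul, quadraticChar_ringEquiv]
  have hsign := setSign_image (triangularAut τ k s m L) (invSet α β ε) ![-(t * c) / 2, 0, c]
  rw [h, setSign_invSet hF, setSign_invSet hF, hsource, htarget] at hsign
  have hsq : quadraticChar F c ^ 2 * quadraticChar F k ^ 2 = 1 := by
    rw [quadraticChar_sq_one hc, quadraticChar_sq_one hk, one_mul]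
  linear_combination (quadraticChar F c * quadraticChar F k) * hsign -
    ε' (m ^ 2 / k ^ 2 + s ^ 2 * τ t - 2 * L c / (k * τ c)) * hsq +
    quadraticChar F k * ε t * quadraticChar_sq_one hc

lemma exists_sum_eq_unit (hF : Nat.card F % 4 = 3) (hD : IsSkewHadamard (invSet α β ε)) :
    ∃ u : ℤˣ, ∑ t, (ε t : ℤ) = u := by
  have h2 : (2 : F) ≠ 0 := (neZero_two_of_natCard_mod_four hF).out
  rw [isSkewHadamard_invSet_iff hF] at hD
  rcases quadraticChar_dichotomy h2 with h | h
  · exact ⟨α, by rw [hD, h, one_mul]⟩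
  · exact ⟨-α, by rw [hD, h, neg_one_mul, Units.val_neg]⟩

lemma triangularAut_eq_semilinearAut_of_image {L : F →+ F} (hF : Nat.card F % 4 = 3)
    (h : triangularAut τ k s m L '' invSet α β ε = invSet α' β' ε')
    (hD : IsSkewHadamard (invSet α' β' ε')) :
    triangularAut τ k s m L = semilinearAut τ k s m (L 1) := by
  have := neZero_two_of_natCard_mod_four hF
  have h2 : (2 : F) ≠ 0 := two_ne_zero
  have hk := k.ne_zero
  obtain ⟨u, hu⟩ := exists_sum_eq_unit hF hD
  have hL {c : F} (hc : c ≠ 0) : L c = L 1 * τ c := by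
    have hτc : τ c ≠ 0 := (map_ne_zero_iff τ τ.injective).2 hc
    have hperiod (t : F) : ε' (t + (2 * L 1 / k - 2 * L c / (k * τ c))) = ε' t := by
      obtain ⟨t, rfl⟩ : ∃ t', m ^ 2 / k ^ 2 + s ^ 2 * τ t' - 2 * L 1 / k = t := by
        refine ⟨τ.symm ((t - m ^ 2 / k ^ 2 + 2 * L 1 / k) / s ^ 2), ?_⟩
        rw [RingEquiv.apply_symm_apply, mul_div_cancel₀ _ (pow_ne_zero 2 s.ne_zero)]
        ring
      have h1 := sign_eq_of_image hF h one_ne_zero t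
      rw [map_one τ, mul_one] at h1
      apply Units.ext
      rw [h1, ← sign_eq_of_image hF h hc t]
      congr 2
      ring
    have hd := eq_zero_of_period hu hperiod
    field_simp at hd
    apply mul_left_cancel₀ h2
    linear_combination -hd
  refine triangularAut_eq_semilinearAut fun r => ?_
  by_cases hr : r = 0
  · simp [hr]
  · exact hL (mul_ne_zero hr hr)

omit [Fintype F] [DecidableEq F] in
lemma exists_semilinearAut_refl_pow_eq (k s : Fˣ) (m l : F) (i : ℕ) :
    ∃ m' l', semilinearAut (RingEquiv.refl F) k s m l ^ i =
      semilinearAut (RingEquiv.refl F) (k ^ i) (s ^ i) m' l' := by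
  induction i with
  | zero =>
    refine ⟨0, 0, LinearEquiv.ext fun v => ?_⟩
    ext i
    fin_cases i <;> simp [semilinearAut_apply]
  | succ i ih =>
    obtain ⟨m', l', h⟩ := ih
    refine ⟨k ^ i * s ^ i * m + m' * k, k ^ i * (s ^ i) ^ 2 * l + m' * s ^ i * m + l' * k,
      LinearEquiv.ext fun v => ?_⟩
    rw [pow_succ, h, LinearEquiv.mul_apply]
    ext i
    fin_cases i <;> simp [semilinearAut_apply] <;> ring

/-- A `p`-power order forces `k = s = 1`, and then `φ` shifts `ε` by `m ^ 2 - 2 * l`. -/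
lemma semilinearAut_refl_mem_groupE {l : F} (hF : Nat.card F % 4 = 3)
    (h : semilinearAut (RingEquiv.refl F) k s m l '' invSet α β ε = invSet α β ε)
    (hD : IsSkewHadamard (invSet α β ε)) {p j : ℕ} [Fact p.Prime] [CharP F p]
    (hpow : semilinearAut (RingEquiv.refl F) k s m l ^ p ^ j = 1) :
    semilinearAut (RingEquiv.refl F) k s m l ∈ groupE F := by
  have := neZero_two_of_natCard_mod_four hF
  have h2 : (2 : F) ≠ 0 := two_ne_zero
  have hone : (1 : AutV F) = semilinearAut (RingEquiv.refl F) 1 1 0 0 := by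
    rw [← eAut_zero, eAut, zero_pow two_ne_zero, zero_div]
  have hunit {x : Fˣ} (hx : x ^ p ^ j = 1) : x = 1 := by
    have hx' : (x : F) ^ (p ^ j * 1) = 1 := by rw [mul_one, ← Units.val_pow_eq_pow_val, hx]; rfl
    simpa using (ExpChar.pow_prime_pow_mul_eq_one_iff p j 1 (x : F)).1 hx'
  obtain ⟨m', l', hml⟩ := exists_semilinearAut_refl_pow_eq k s m l (p ^ j)
  rw [hpow, hone] at hml
  obtain ⟨-, hk, hs, -, -⟩ := semilinearAut_injective hml
  obtain rfl := hunit hk.symm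
  obtain rfl := hunit hs.symm
  obtain ⟨u, hu⟩ := exists_sum_eq_unit hF hD
  have hl : m ^ 2 - 2 * l = 0 := by
    refine eq_zero_of_period hu fun t => Units.ext ?_
    have hsign : (ε (m ^ 2 + t - 2 * l) : ℤ) = ε t := by
      simpa using sign_eq_of_image hF h one_ne_zero t
    rw [← hsign]
    congr 2
    ring
  refine mem_groupE.2 ⟨m, ?_⟩
  rw [eAut]
  congr 1
  field_simp
  linear_combination hl

end Isomorphism

section SemilinearExtensions

variable {F : Type*} [Field F]

lemma semilinearAut_smul (τ : F ≃+* F) (k s : Fˣ) (m l c : F) (v : Fin 3 → F) :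
    semilinearAut τ k s m l (c • v) = τ c • semilinearAut τ k s m l v := by
  ext i
  fin_cases i <;> simp [semilinearAut_apply] <;> ring

lemma eq_refl_of_semilinearAut_smul {τ : F ≃+* F} {k s : Fˣ} {m l : F}
    (h : ∀ (c : F) v, semilinearAut τ k s m l (c • v) = c • semilinearAut τ k s m l v) :
    τ = RingEquiv.refl F := by
  ext c
  simpa [semilinearAut_apply, mul_comm c] using congrFun (h c ![0, 0, 1]) 2

lemma natCard_fixed_semilinearAut_le [Finite F] (τ : F ≃+* F) (k s : Fˣ) (m l : F) :
    Nat.card {v // semilinearAut τ k s m l v = v} ≤ Nat.card {c // τ c = c} ^ 3 := by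
  let φ : (Fin 3 → F) →ₛₗ[τ.toRingHom] (Fin 3 → F) :=
    { toFun := semilinearAut τ k s m l
      map_add' := map_add _
      map_smul' := semilinearAut_smul τ k s m l }
  exact (natCard_fixed_le_of_semilinear φ).trans_eq (by rw [Module.finrank_fin_fun]; rfl)

variable [NeZero (2 : F)]

variable (F) in
lemma natCard_groupE : Nat.card (groupE F) = Nat.card F := by
  have hinj : Function.Injective (eHom : Multiplicative F →* AutV F) := eAut_injective (F := F)
  rw [groupE_eq_range, ← Nat.card_congr (MonoidHom.ofInjective hinj).toEquiv]
  rfl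

lemma mul_comm_of_mem_groupE {a b : AutV F} (ha : a ∈ groupE F) (hb : b ∈ groupE F) :
    a * b = b * a := by
  obtain ⟨x, rfl⟩ := mem_groupE.1 ha
  obtain ⟨y, rfl⟩ := mem_groupE.1 hb
  rw [eAut_mul, eAut_mul, add_comm]

variable [Finite F]

/-- `semilinearAut τ k s m l` commutes with `E(x)` only if `s τ(x) = x`. -/
lemma natCard_groupE_inf_centralizer_le (τ : F ≃+* F) (k s : Fˣ) (m l : F) :
    Nat.card (groupE F ⊓ Subgroup.centralizer {semilinearAut τ k s m l} : Subgroup (AutV F)) ≤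
      Nat.card {c // τ c = c} := by
  let φ : F →ₛₗ[τ.toRingHom] F :=
    { toFun x := s * τ x
      map_add' x y := by rw [map_add, mul_add]
      map_smul' c x := by
        rw [smul_eq_mul, map_mul, mul_left_comm]
        rfl }
  have hφ (g : (groupE F ⊓ Subgroup.centralizer {semilinearAut τ k s m l} : Subgroup (AutV F))) :
      ∃ x : {x // φ x = x}, eAut x.1 = g.1 := by
    obtain ⟨x, hx⟩ := mem_groupE.1 g.2.1
    have hcomm := Subgroup.mem_centralizer_singleton_iff.1 g.2.2
    rw [← hx, semilinearAut, triangularAut_mul_eAut] at hcomm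
    exact ⟨⟨x, eAut_injective (mul_right_cancel hcomm).symm⟩, hx⟩
  choose x hx using hφ
  refine (Nat.card_le_card_of_injective x fun g g' h => Subtype.ext ?_).trans ?_
  · rw [← hx, ← hx, h]
  · simpa using natCard_fixed_le_of_semilinear φ

omit [NeZero (2 : F)] in
lemma natCard_fixed_mul_natCard_ringAut_lt {τ : F ≃+* F}
    (hcard : Nat.card (F ≃+* F) ^ 2 < Nat.card F) (hτ : τ ≠ RingEquiv.refl F) :
    Nat.card {c // τ c = c} * Nat.card (F ≃+* F) < Nat.card F := by
  refine lt_of_pow_lt_pow_left₀ 2 (Nat.zero_le _) ?_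
  calc (Nat.card {c // τ c = c} * Nat.card (F ≃+* F)) ^ 2 =
        Nat.card {c // τ c = c} ^ 2 * Nat.card (F ≃+* F) ^ 2 := mul_pow _ _ 2
    _ ≤ Nat.card F * Nat.card (F ≃+* F) ^ 2 := Nat.mul_le_mul_right _ (sq_natCard_fixed_le hτ)
    _ < Nat.card F * Nat.card F := Nat.mul_lt_mul_of_pos_left hcard Nat.card_pos
    _ = Nat.card F ^ 2 := (sq _).symm

/-- The subgroups between `E` and the normalizer of `A` whose `F`-linear elements all lie in `E`.
The linear parts of a `p`-group of automorphisms of a translation design form such a subgroup if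
the `p`-group contains and normalizes the affine group `V E`. -/
structure IsSemilinearExtension (Γ : Subgroup (AutV F)) : Prop where
  groupE_le : groupE F ≤ Γ
  le_normalizer : Γ ≤ Subgroup.normalizer (groupA F : Set (AutV F))
  mem_groupE_of_smul : ∀ φ ∈ Γ, (∀ (c : F) v, φ (c • v) = c • φ v) → φ ∈ groupE F

namespace IsSemilinearExtension

variable {Γ : Subgroup (AutV F)} (hΓ : IsSemilinearExtension Γ)
include hΓ

lemma exists_eq_semilinearAut {φ : AutV F} (hφ : φ ∈ Γ) :
    ∃ τ k s m l, φ = semilinearAut τ k s m l ∧ (τ = RingEquiv.refl F → φ ∈ groupE F) := by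
  obtain ⟨τ, k, s, m, l, rfl⟩ := mem_normalizer_groupA.1 (hΓ.le_normalizer hφ)
  refine ⟨τ, k, s, m, l, rfl, ?_⟩
  rintro rfl
  exact hΓ.mem_groupE_of_smul _ hφ (semilinearAut_smul _ k s m l)

lemma relIndex_groupE_le : (groupE F).relIndex Γ ≤ Nat.card (F ≃+* F) := by
  have hsemi (φ : Γ) : ∃ τ : F ≃+* F, ∀ (c : F) v, φ.1 (c • v) = τ c • φ.1 v := by
    obtain ⟨τ, k, s, m, l, hφ, -⟩ := hΓ.exists_eq_semilinearAut φ.2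
    exact ⟨τ, fun c v => by rw [hφ, semilinearAut_smul]⟩
  choose τ hτ using hsemi
  have : Finite (F ≃+* F) := DFunLike.finite _
  refine relIndex_le_natCard τ fun φ χ h => ?_
  refine hΓ.mem_groupE_of_smul _ (mul_mem (inv_mem φ.2) χ.2) fun c v => φ.1.injective ?_
  rw [hτ φ, ← LinearEquiv.mul_apply, ← LinearEquiv.mul_apply, mul_inv_cancel_left, hτ χ, h]

lemma natCard_le : Nat.card Γ ≤ Nat.card F * Nat.card (F ≃+* F) :=
  calc Nat.card Γ = Nat.card (groupE F) * (groupE F).relIndex Γ := by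
        simpa only [Subgroup.relIndex_bot_left] using
          (Subgroup.relIndex_mul_relIndex ⊥ (groupE F) Γ bot_le hΓ.groupE_le).symm
    _ ≤ Nat.card F * Nat.card (F ≃+* F) := by
        rw [natCard_groupE]
        exact Nat.mul_le_mul_left _ hΓ.relIndex_groupE_le

variable (hcard : Nat.card (F ≃+* F) ^ 2 < Nat.card F)
include hcard

lemma natCard_fixed_mul_natCard_lt {φ : AutV F} (hφ : φ ∈ Γ) (hφ1 : φ ≠ 1) :
    Nat.card {v // φ v = v} * Nat.card Γ < Nat.card (Fin 3 → F) := by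
  have hq : 0 < Nat.card F := Nat.card_pos
  obtain ⟨τ, k, s, m, l, rfl, hrefl⟩ := hΓ.exists_eq_semilinearAut hφ
  refine (Nat.mul_le_mul_left _ hΓ.natCard_le).trans_lt ?_
  rw [natCard_fin_three]
  set f := Nat.card {v // semilinearAut τ k s m l v = v} with hf
  by_cases hτ : τ = RingEquiv.refl F
  · obtain ⟨x, hx⟩ := mem_groupE.1 (hrefl hτ)
    have hx0 : x ≠ 0 := by
      rintro rfl
      exact hφ1 (hx ▸ eAut_zero)
    have hfq : f ≤ Nat.card F := by
      rw [hf, ← hx]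
      exact natCard_fixed_eAut_le hx0
    have hn : Nat.card (F ≃+* F) < Nat.card F := (Nat.le_self_pow two_ne_zero _).trans_lt hcard
    calc f * (Nat.card F * Nat.card (F ≃+* F)) ≤
          Nat.card F * (Nat.card F * Nat.card (F ≃+* F)) := Nat.mul_le_mul_right _ hfq
      _ < Nat.card F * (Nat.card F * Nat.card F) := by gcongr
      _ = Nat.card F ^ 3 := by ring
  · have hlt := natCard_fixed_mul_natCard_ringAut_lt hcard hτ
    calc f * (Nat.card F * Nat.card (F ≃+* F)) ≤
          Nat.card {c // τ c = c} ^ 3 * (Nat.card F * Nat.card (F ≃+* F)) :=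
          Nat.mul_le_mul_right _ (natCard_fixed_semilinearAut_le τ k s m l)
      _ = Nat.card {c // τ c = c} ^ 2 *
          (Nat.card F * (Nat.card {c // τ c = c} * Nat.card (F ≃+* F))) := by ring
      _ ≤ Nat.card F * (Nat.card F * (Nat.card {c // τ c = c} * Nat.card (F ≃+* F))) :=
          Nat.mul_le_mul_right _ (sq_natCard_fixed_le hτ)
      _ < Nat.card F * (Nat.card F * Nat.card F) := by gcongr
      _ = Nat.card F ^ 3 := by ring

/-- An element outside `E` has a nontrivial field automorphism `τ`; it commutes with the
intersection of `E` and its conjugate, which is too large for that. -/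
lemma conj_smul_groupE_le {χ : AutV F} (h : MulAut.conj χ • groupE F ≤ Γ) :
    MulAut.conj χ • groupE F ≤ groupE F := by
  intro φ hφ
  obtain ⟨τ, k, s, m, l, rfl, hrefl⟩ := hΓ.exists_eq_semilinearAut (h hφ)
  by_contra hφE
  have hcomm : groupE F ⊓ MulAut.conj χ • groupE F ≤
      groupE F ⊓ Subgroup.centralizer {semilinearAut τ k s m l} := by
    refine inf_le_inf_left _ fun e he => Subgroup.mem_centralizer_singleton_iff.2 ?_
    obtain ⟨a, ha, rfl⟩ := he
    obtain ⟨b, hb, hbφ⟩ := hφ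
    rw [← hbφ]
    exact (map_mul (MulAut.conj χ) a b).symm.trans
      ((congrArg (MulAut.conj χ) (mul_comm_of_mem_groupE ha hb)).trans
        (map_mul (MulAut.conj χ) b a))
  refine (natCard_fixed_mul_natCard_ringAut_lt hcard (mt hrefl hφE)).not_ge ?_
  calc Nat.card F = Nat.card ↥(MulAut.conj χ • groupE F) := by
        rw [natCard_conj_smul, natCard_groupE]
    _ ≤ Nat.card (groupE F ⊓ MulAut.conj χ • groupE F : Subgroup (AutV F)) *
        (groupE F).relIndex Γ := natCard_le_natCard_inf_mul_relIndex h
    _ ≤ Nat.card {c // τ c = c} * Nat.card (F ≃+* F) :=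
        Nat.mul_le_mul ((Subgroup.card_le_of_le hcomm).trans
          (natCard_groupE_inf_centralizer_le τ k s m l)) hΓ.relIndex_groupE_le

lemma conj_smul_affinePerm_groupE_eq {w : Equiv.Perm (Fin 3 → F)}
    (h : MulAut.conj w • affinePerm (groupE F) ≤ affinePerm Γ) :
    MulAut.conj w • affinePerm (groupE F) = affinePerm (groupE F) := by
  obtain ⟨χ, c, hw⟩ := exists_affine_of_conj_smul_le_affinePerm
    ((Subgroup.pointwise_smul_le_pointwise_smul_iff.2 (affinePerm_mono bot_le)).trans h)
    fun φ hφ hφ1 => hΓ.natCard_fixed_mul_natCard_lt hcard hφ hφ1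
  rw [conj_smul_affinePerm _ hw, affinePerm_le_affinePerm_iff] at h
  rw [conj_smul_affinePerm _ hw]
  exact congrArg affinePerm (Subgroup.eq_of_le_of_card_ge (hΓ.conj_smul_groupE_le hcard h)
    (natCard_conj_smul _ _).ge)

end IsSemilinearExtension

lemma exists_affine_of_mem_normalizer_affinePerm_groupE {w : Equiv.Perm (Fin 3 → F)}
    (hw : w ∈ Subgroup.normalizer (affinePerm (groupE F) : Set (Equiv.Perm (Fin 3 → F)))) :
    ∃ (τ : F ≃+* F) (k s : Fˣ) (m : F) (L : F →+ F) (h : Fin 3 → F),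
      ∀ v, w v = triangularAut τ k s m L v + h := by
  have hconj := mem_normalizer_iff_conj_smul_eq.1 hw
  have hq : 1 < Nat.card F := Finite.one_lt_card
  obtain ⟨φ, h, hφ⟩ := exists_affine_of_conj_smul_le_affinePerm (Γ := groupE F)
    ((Subgroup.pointwise_smul_le_pointwise_smul_iff.2 (affinePerm_mono bot_le)).trans hconj.le) (by
      intro e he he1
      obtain ⟨x, rfl⟩ := mem_groupE.1 he
      have hx : x ≠ 0 := by
        rintro rfl
        exact he1 eAut_zero
      rw [natCard_groupE, natCard_fin_three]
      calc _ ≤ Nat.card F * Nat.card F := Nat.mul_le_mul_right _ (natCard_fixed_eAut_le hx)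
        _ = Nat.card F ^ 2 := (sq _).symm
        _ < Nat.card F ^ 3 := Nat.pow_lt_pow_right hq (by norm_num))
  rw [conj_smul_affinePerm _ hφ] at hconj
  obtain ⟨σ, hσ⟩ := exists_conjugatesE fun g hg =>
    (affinePerm_injective hconj).le ⟨g, hg, rfl⟩
  obtain ⟨τ, k, s, m, L, rfl⟩ := hσ.exists_eq_triangularAut
  exact ⟨τ, k, s, m, L, h, hφ⟩

end SemilinearExtensions

section IsomorphismClasses

lemma smul_translationDesign {V : Type*} [AddCommGroup V] {D : Set V} {w : Equiv.Perm V}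
    {φ : V ≃ₗ[ℤ] V} {h : V} (hw : ∀ v, w v = φ v + h) :
    w • translationDesign D = translationDesign (φ '' D) := by
  have htranslate (k : V) :
      w • ((fun d => d + k) '' D) = (fun d => d + (φ k + h)) '' (φ '' D) := by
    change w '' _ = _
    rw [Set.image_image, Set.image_image]
    exact Set.image_congr fun d _ => by rw [hw, map_add, add_assoc]
  ext B
  constructor
  · rintro ⟨_, ⟨k, rfl⟩, rfl⟩
    exact ⟨_, htranslate k⟩
  · rintro ⟨k, rfl⟩
    refine ⟨_, ⟨φ.symm (k - h), rfl⟩, (htranslate _).trans ?_⟩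
    rw [LinearEquiv.apply_symm_apply, sub_add_cancel]

lemma mem_translationDesign_self {V : Type*} [AddCommGroup V] (D : Set V) :
    D ∈ translationDesign D :=
  ⟨0, by simp⟩

lemma three_lt_natCard_fin_three {X : Type*} (hX : Nat.card X % 4 = 3) :
    3 < Nat.card (Fin 3 → X) := by
  rw [natCard_fin_three]
  calc 3 < 3 ^ 3 := by norm_num
    _ ≤ Nat.card X ^ 3 := Nat.pow_le_pow_left (by lia) 3

variable {F : Type*} [Field F]

lemma affinePerm_groupE_le_stabilizer {D : Set (Fin 3 → F)} (hA : ∀ g ∈ groupA F, g '' D = D) :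
    affinePerm (groupE F) ≤
      MulAction.stabilizer (Equiv.Perm (Fin 3 → F)) (translationDesign D) := by
  rintro w ⟨φ, hφ, h, hw⟩
  rw [MulAction.mem_stabilizer_iff, smul_translationDesign hw, hA φ (groupE_le_groupA hφ)]

variable [Finite F] {D D' : Set (Fin 3 → F)}

lemma image_eq_of_smul_translationDesign_eq (hF : Nat.card F % 4 = 3) (hD : IsSkewHadamard D)
    (hD' : IsSkewHadamard D') {w : Equiv.Perm (Fin 3 → F)} {φ : AutV F} {h : Fin 3 → F}
    (hw : ∀ v, w v = φ v + h) (hdes : w • translationDesign D = translationDesign D') :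
    φ '' D = D' := by
  rw [smul_translationDesign hw] at hdes
  exact hD'.eq_of_mem_translationDesign (three_lt_natCard_fin_three hF)
    (hD.image_addEquiv φ.toAddEquiv).isSkew (hdes ▸ mem_translationDesign_self _)

lemma exists_mem_normalizer_groupA_of_mem_normalizer (hF : Nat.card F % 4 = 3)
    (hD : D ∈ invariantSHDS F) (hD' : D' ∈ invariantSHDS F) {w : Equiv.Perm (Fin 3 → F)}
    (hw : w ∈ Subgroup.normalizer (affinePerm (groupE F) : Set (Equiv.Perm (Fin 3 → F))))
    (hdes : w • translationDesign D = translationDesign D') :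
    ∃ φ ∈ Subgroup.normalizer (groupA F : Set (AutV F)),
      ∃ h, (∀ v, w v = φ v + h) ∧ φ '' D = D' := by
  classical
  have := Fintype.ofFinite F
  have := neZero_two_of_natCard_mod_four hF
  obtain ⟨τ, k, s, m, L, h, hφ⟩ := exists_affine_of_mem_normalizer_affinePerm_groupE hw
  have himage := image_eq_of_smul_translationDesign_eq hF hD.1 hD'.1 hφ hdes
  refine ⟨_, mem_normalizer_groupA.2 ⟨τ, k, s, m, L 1, ?_⟩, h, hφ, himage⟩
  obtain ⟨α, β, ε, rfl⟩ := exists_eq_invSet hF hD.1.isSkew hD.2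
  obtain ⟨α', β', ε', rfl⟩ := exists_eq_invSet hF hD'.1.isSkew hD'.2
  exact triangularAut_eq_semilinearAut_of_image hF himage hD'.1

lemma isSemilinearExtension_comap_linPerm (hF : Nat.card F % 4 = 3) {p : ℕ} [Fact p.Prime]
    [CharP F p] (hD : D ∈ invariantSHDS F) {R : Subgroup (Equiv.Perm (Fin 3 → F))}
    (hER : affinePerm (groupE F) ≤ R)
    (hRD : R ≤ MulAction.stabilizer (Equiv.Perm (Fin 3 → F)) (translationDesign D))
    (hRE : R ≤ Subgroup.normalizer (affinePerm (groupE F) : Set (Equiv.Perm (Fin 3 → F))))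
    (hR : IsPGroup p R) : IsSemilinearExtension (R.comap (linPerm (V := Fin 3 → F))) := by
  classical
  have := Fintype.ofFinite F
  have := neZero_two_of_natCard_mod_four hF
  have hN {φ : AutV F} (hφ : linPerm φ ∈ R) :
      φ ∈ Subgroup.normalizer (groupA F : Set (AutV F)) ∧ φ '' D = D := by
    obtain ⟨χ, hχ, h, hφχ, hχD⟩ :=
      exists_mem_normalizer_groupA_of_mem_normalizer hF hD hD (hRE hφ) (hRD hφ)
    obtain rfl : φ = χ := (linearPart_unique (h := 0) fun v => (add_zero _).trans (hφχ v)).1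
    exact ⟨hχ, hχD⟩
  refine ⟨fun φ hφ => hER (linPerm_mem_affinePerm_iff.2 hφ), fun φ hφ => (hN hφ).1,
    fun φ hφ hlin => ?_⟩
  obtain ⟨hφN, hφD⟩ := hN hφ
  obtain ⟨τ, k, s, m, l, rfl⟩ := mem_normalizer_groupA.1 hφN
  obtain rfl := eq_refl_of_semilinearAut_smul hlin
  obtain ⟨α, β, ε, rfl⟩ := exists_eq_invSet hF hD.1.isSkew hD.2
  obtain ⟨j, hj⟩ := hR ⟨_, hφ⟩
  refine semilinearAut_refl_mem_groupE hF hφD hD.1 (p := p) (j := j) (LinearEquiv.ext fun v => ?_)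
  have hpow := congrArg Subtype.val hj
  rw [SubmonoidClass.coe_pow, ← map_pow] at hpow
  exact DFunLike.congr_fun hpow v

lemma sq_lt_three_pow (n : ℕ) : n ^ 2 < 3 ^ n := by
  induction n with
  | zero => norm_num
  | succ n ih =>
    rcases n with _ | _ | n
    · norm_num
    · norm_num
    · rw [pow_succ 3]
      nlinarith

lemma sq_natCard_ringAut_lt (hF : Nat.card F % 4 = 3) : Nat.card (F ≃+* F) ^ 2 < Nat.card F := by
  have := Fintype.ofFinite F
  obtain ⟨p, -, n, hp, hcard⟩ := FiniteField.card' F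
  rw [← Nat.card_eq_fintype_card] at hcard
  have hp3 : 3 ≤ p := by
    refine hp.two_le.lt_of_ne' ?_
    rintro rfl
    have : Even (Nat.card F) := hcard ▸ Nat.even_pow.2 ⟨even_two, n.ne_zero⟩
    grind
  rw [natCard_ringAut hp hcard, hcard]
  exact (sq_lt_three_pow n).trans_le (Nat.pow_le_pow_left hp3 n)

lemma exists_mem_normalizer_groupA_of_designIso (hF : Nat.card F % 4 = 3)
    (hD : D ∈ invariantSHDS F) (hD' : D' ∈ invariantSHDS F)
    (hiso : DesignIso (translationDesign D) (translationDesign D')) :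
    ∃ φ ∈ Subgroup.normalizer (groupA F : Set (AutV F)), φ '' D = D' := by
  have := Fintype.ofFinite F
  have := neZero_two_of_natCard_mod_four hF
  obtain ⟨p, _, n, hp, hcard⟩ := FiniteField.card' F
  rw [← Nat.card_eq_fintype_card] at hcard
  have := Fact.mk hp
  obtain ⟨g, hg⟩ := hiso
  change g • translationDesign D = translationDesign D' at hg
  have hP : IsPGroup p (affinePerm (groupE F)) := by
    refine IsPGroup.of_card (n := n * 4) ?_
    rw [natCard_affinePerm, natCard_groupE, natCard_fin_three, hcard]
    ring
  have hgP : MulAut.conj g • affinePerm (groupE F) ≤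
      MulAction.stabilizer (Equiv.Perm (Fin 3 → F)) (translationDesign D') := by
    rw [← hg, MulAction.stabilizer_smul_eq_stabilizer_map_conj]
    exact Subgroup.map_mono (affinePerm_groupE_le_stabilizer hD.2)
  obtain ⟨x, hx, hxg⟩ := exists_mul_mem_normalizer (affinePerm_groupE_le_stabilizer hD'.2) hP
    (fun R hER hRD hRE hR y hy => by
      have hΓ := isSemilinearExtension_comap_linPerm hF hD' hER hRD hRE hR
      refine hΓ.conj_smul_affinePerm_groupE_eq (sq_natCard_ringAut_lt hF) (hy.trans ?_)
      refine le_affinePerm_comap_linPerm ((affinePerm_mono bot_le).trans hER) fun r hr => ?_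
      obtain ⟨τ, k, s, m, L, h, hr⟩ := exists_affine_of_mem_normalizer_affinePerm_groupE (hRE hr)
      exact ⟨_, h, hr⟩) hgP
  obtain ⟨φ, hφ, -, -, hφD⟩ := exists_mem_normalizer_groupA_of_mem_normalizer hF hD hD' hxg
    (by rw [mul_smul, hg, MulAction.mem_stabilizer_iff.1 hx])
  exact ⟨φ, hφ, hφD⟩

lemma ncard_invariantSHDS_le (hF : Nat.card F % 4 = 3) :
    (invariantSHDS F).ncard ≤
      (groupA F).relIndex (Subgroup.normalizer (groupA F : Set (AutV F))) *
        numIsoClasses (invariantDesigns F) := by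
  classical
  set N := Subgroup.normalizer (groupA F : Set (AutV F))
  let isoClass (D : Set (Fin 3 → F)) : Quotient (designSetoid (Fin 3 → F)) :=
    Quotient.mk _ (translationDesign D)
  have hfin : (invariantSHDS F).Finite := Set.toFinite _
  have hclasses : numIsoClasses (invariantDesigns F) = (hfin.toFinset.image isoClass).card := by
    rw [numIsoClasses, invariantDesigns, Set.image_image, ← Set.ncard_coe_finset,
      Finset.coe_image, hfin.coe_toFinset]
  rw [hclasses, Set.ncard_eq_toFinset_card _ hfin]
  refine Finset.card_le_mul_card_image _ _ fun c hc => ?_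
  obtain ⟨D, hD, rfl⟩ := Finset.mem_image.1 hc
  rw [Set.Finite.mem_toFinset] at hD
  have horbit (D' : hfin.toFinset.filter (isoClass · = isoClass D)) : ∃ φ : N, φ.1 '' D = D' := by
    obtain ⟨hD', hclass⟩ := Finset.mem_filter.1 D'.2
    obtain ⟨φ, hφ, hφD⟩ := exists_mem_normalizer_groupA_of_designIso hF hD
      (hfin.mem_toFinset.1 hD') (Quotient.exact hclass.symm)
    exact ⟨⟨φ, hφ⟩, hφD⟩
  choose φ hφ using horbit
  rw [Subgroup.relIndex, Subgroup.index, ← Fintype.card_coe, ← Nat.card_eq_fintype_card]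
  refine Nat.card_le_card_of_injective
    (fun D' => (φ D' : N ⧸ (groupA F).subgroupOf N)) fun D₁ D₂ h12 => Subtype.ext ?_
  have hstab : (φ D₁).1⁻¹ • (φ D₂).1 • D = D := by
    rw [← mul_smul]
    exact hD.2 _ (Subgroup.mem_subgroupOf.1 (QuotientGroup.eq.1 h12))
  exact (hφ D₁).symm.trans ((inv_smul_eq_iff.1 hstab).symm.trans (hφ D₂))

end IsomorphismClasses

section DesignCount

variable {F : Type*} [Field F] [Finite F]

lemma isSymmetricDesign_of_mem_invariantDesigns (hF : Nat.card F % 4 = 3)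
    {𝓑 : Set (Set (Fin 3 → F))} (h𝓑 : 𝓑 ∈ invariantDesigns F) :
    IsSymmetricDesign 𝓑 (Nat.card F ^ 3) ((Nat.card F ^ 3 - 1) / 2)
      ((Nat.card F ^ 3 - 3) / 4) := by
  obtain ⟨D, hD, rfl⟩ := h𝓑
  simpa only [natCard_fin_three] using hD.1.isSymmetricDesign (three_lt_natCard_fin_three hF)

lemma ncard_invariantDesigns (hF : Nat.card F % 4 = 3) :
    (invariantDesigns F).ncard = 4 * (Nat.card F).choose ((Nat.card F + 1) / 2) := by
  classical
  have := Fintype.ofFinite F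
  have hinj := IsSkewHadamard.injOn_translationDesign (three_lt_natCard_fin_three hF)
  rw [invariantDesigns, (hinj.mono fun D hD => hD.1).ncard_image, ncard_invariantSHDS hF]

end DesignCount

section Estimates

lemma pow_mod_four_of_odd {p n : ℕ} (hp : p % 4 = 3) (hn : Odd n) : p ^ n % 4 = 3 := by
  obtain ⟨r, rfl⟩ := hn
  rw [pow_succ, pow_mul, Nat.mul_mod, Nat.pow_mod, Nat.pow_mod p 2, hp]
  norm_num

lemma two_pow_lt_mul_choose {q : ℕ} (hq : Odd q) (hq3 : 3 ≤ q) :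
    2 ^ q < q * q.choose ((q + 1) / 2) := by
  obtain ⟨r, rfl⟩ := hq
  set C := (2 * r + 1).choose r
  have hsymm : (2 * r + 1).choose ((2 * r + 1 + 1) / 2) = C := by
    rw [show (2 * r + 1 + 1) / 2 = r + 1 by omega, Nat.choose_symm_half]
  have hmax (i : ℕ) : (2 * r + 1).choose i ≤ C := by
    simpa only [show (2 * r + 1) / 2 = r by omega] using Nat.choose_le_middle i (2 * r + 1)
  have hlt : 2 < C := by
    have := hmax 1
    rw [Nat.choose_one_right] at this
    omega
  have hhalf : 4 ^ r ≤ r * C + 1 := by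
    rw [← Nat.sum_range_choose_halfway, Finset.sum_range_succ', Nat.choose_zero_right]
    simpa using Finset.sum_le_card_nsmul (Finset.range r) _ C fun i _ => hmax (i + 1)
  calc 2 ^ (2 * r + 1) = 2 * 4 ^ r := by rw [pow_succ, pow_mul, mul_comm]; norm_num
    _ < (2 * r + 1) * C := by linarith
    _ = _ := by rw [hsymm]

lemma two_pow_add_two_div_lt {q : ℕ} (hq : Odd q) (hq3 : 3 ≤ q) :
    (2 : ℝ) ^ (q + 2) / q < 4 * q.choose ((q + 1) / 2) := by
  have hlt : (2 : ℝ) ^ q < q * q.choose ((q + 1) / 2) := mod_cast two_pow_lt_mul_choose hq hq3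
  rw [div_lt_iff₀ (by positivity), pow_add]
  linarith

lemma two_pow_succ_div_pow_four_lt {n q : ℕ} (hn : 0 < n) (hq : 1 < q) (hnq : n ≤ q) :
    (2 : ℝ) ^ (q + 1) / (q : ℝ) ^ 4 < ((2 : ℝ) ^ (q + 2) / q) / (2 * n * q * (q - 1)) := by
  have hn' : (0 : ℝ) < n := mod_cast hn
  have hq' : (1 : ℝ) < q := mod_cast hq
  have hnq' : (n : ℝ) ≤ q := mod_cast hnq
  have hq1 : (0 : ℝ) < q - 1 := sub_pos.2 hq'
  calc (2 : ℝ) ^ (q + 1) / (q : ℝ) ^ 4 < 2 ^ (q + 1) / (n * (q - 1) * q ^ 2) := by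
        refine div_lt_div_of_pos_left (by positivity) (by positivity) ?_
        have hlt : (n : ℝ) * (q - 1) < q * q := by nlinarith
        calc (n : ℝ) * (q - 1) * (q : ℝ) ^ 2 < q * q * (q : ℝ) ^ 2 := by gcongr
          _ = (q : ℝ) ^ 4 := by ring
    _ = _ := by field_simp; ring

end Estimates

theorem mainTheorem3 (p n q : ℕ) (hp : p.Prime) (hp4 : p % 4 = 3) (hn : Odd n) (hq : q = p ^ n)
    (F : Type*) [Field F] [Finite F] (hF : Nat.card F = q) :
    -- the order of the normalizer of `A` in `Aut(V)`, and the index of `A` in it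
    Nat.card (Subgroup.normalizer (groupA F : Set (AutV F))) = n * (q - 1) ^ 2 * q ^ 2 ∧
    (groupA F).relIndex (Subgroup.normalizer (groupA F : Set (AutV F))) =
      2 * n * (q - 1) * q ∧
    -- the constructed designs are symmetric designs, and their number
    (∀ 𝓑 ∈ invariantDesigns F,
      IsSymmetricDesign 𝓑 (q ^ 3) ((q ^ 3 - 1) / 2) ((q ^ 3 - 3) / 4)) ∧
    (invariantSHDS F).ncard = 4 * q.choose ((q + 1) / 2) ∧
    (invariantDesigns F).ncard = 4 * q.choose ((q + 1) / 2) ∧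
    -- the number of isomorphism classes of these designs
    (4 * q.choose ((q + 1) / 2) : ℝ) / (2 * n * (q - 1) * q) ≤ numIsoClasses (invariantDesigns F) ∧
    (4 * q.choose ((q + 1) / 2) : ℝ) / (2 * n * (q - 1) * q) >
      ((2 : ℝ) ^ (q + 2) / q) / (2 * n * q * (q - 1)) ∧
    ((2 : ℝ) ^ (q + 2) / q) / (2 * n * q * (q - 1)) > (2 : ℝ) ^ (q + 1) / (q : ℝ) ^ 4 := by
  subst hF
  classical
  have := Fintype.ofFinite F
  have hF : Nat.card F % 4 = 3 := by rw [hq]; exact pow_mod_four_of_odd hp4 hn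
  have := neZero_two_of_natCard_mod_four hF
  have hAut : Nat.card (F ≃+* F) = n := natCard_ringAut hp hq
  have hcard := natCard_normalizer_groupA (F := F)
  have hidx := relIndex_groupA F
  have hclasses := ncard_invariantSHDS_le hF
  rw [hAut] at hcard hidx
  rw [ncard_invariantSHDS hF, hidx] at hclasses
  have hq1 : 1 < Nat.card F := Finite.one_lt_card
  have hqR : (0 : ℝ) < Nat.card F - 1 := sub_pos.2 (mod_cast hq1)
  have hden : (0 : ℝ) < 2 * n * (Nat.card F - 1) * Nat.card F := by have := hn.pos; positivity
  refine ⟨hcard, hidx, fun _ => isSymmetricDesign_of_mem_invariantDesigns hF,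
    ncard_invariantSHDS hF, ncard_invariantDesigns hF, ?_, ?_, ?_⟩
  · rw [div_le_iff₀' hden, ← Nat.cast_pred hq1.le]
    exact mod_cast hclasses
  · rw [mul_right_comm _ (Nat.card F : ℝ)]
    exact div_lt_div_of_pos_right (two_pow_add_two_div_lt (by grind) (by omega)) hden
  · exact two_pow_succ_div_pow_four_lt hn.pos hq1 (hq ▸ (Nat.lt_pow_self hp.one_lt).le)
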